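/- Let $\mathcal O_2$ be the Cuntz algebra, i.e. the universal unital $C^*$-algebra generated by isometries $s_0,s_1$ with $s_0s_0^*+s_1s_1^*=1$, let $\mathbb Z_2=\{0,1\}$ act on $\mathcal O_2$ by the flip ($\alpha_0=\mathrm{id}$, and $\alpha_1$ is the $*$-automorphism with $\alpha_1(s_0)=s_1$, $\alpha_1(s_1)=s_0$), and let $\mathcal O_2\subseteq\mathcal O_2\rtimes\mathbb Z_2$ be the resulting crossed product inclusion. Then: 1. There are an irreducible representation $\pi:\mathcal O_2\to B(L^2[-1,1])$ and a unitary $U\in B(L^2[-1,1])$ such that, for all $f\in L^2[-1,1]$ and almost every $t\in[-1,1]$, $$(\pi(s_0)f)(t)=\sqrt2\,f(2t-1)\chi_{[0,1]}(t),\qquad (\pi(s_1)f)(t)=\sqrt2\,f(2t+1)\chi_{[-1,0]}(t),\qquad (Uf)(t)=f(-t),$$ and $\pi(\alpha_1(x))=U\pi(x)U^*$ for all $x\in\mathcal O_2$. In particular $\pi$ is unitarily equivalent to its twist $\pi\circ\alpha_1$ by the flip. 2. The inclusion $\mathcal O_2\subseteq\mathcal O_2\rtimes\mathbb Z_2$ fails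 the pure extension property: it is not true that every pure state of $\mathcal O_2$ has exactly one extension to a state of $\mathcal O_2\rtimes\mathbb Z_2$. 3. There is exactly one conditional expectation $E:\mathcal O_2\rtimes\mathbb Z_2\to\mathcal O_2$, i.e. exactly one completely positive $\mathcal O_2$-bimodule map which is the identity on $\mathcal O_2$. 4. There is exactly one pseudo-expectation in the sense of Pitts: for every injective envelope $\mathcal O_2\subseteq I(\mathcal O_2)$ (an injective $C^*$-algebra containing $\mathcal O_2$ whose only completely positive self-map fixing $\mathcal O_2$ pointwise is the identity) there is exactly one unital completely positive map $\Phi:\mathcal O_2\rtimes\mathbb Z_2\to I(\mathcal O_2)$ with $\Phi|_{\mathcal O_2}=\mathrm{id}$. -/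

import Mathlib

open MeasureTheory
open scoped ComplexOrder CStarAlgebra

noncomputable section

set_option linter.unusedSectionVars false

/-! ## The Cuntz algebra `𝒪₂` as a universal C⋆-algebra -/

/-- The free complex unital ⋆-algebra on two generators: noncommutative polynomials in the letters
`(i, false)` (the generator `s i`) and `(i, true)` (its adjoint), `i = 0, 1`. -/
def CuntzPoly : Type := MonoidAlgebra ℂ (FreeMonoid (Fin 2 × Bool))

namespace CuntzPoly

instance : Ring CuntzPoly := inferInstanceAs (Ring (MonoidAlgebra ℂ (FreeMonoid (Fin 2 × Bool))))

instance : Algebra ℂ CuntzPoly :=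
  inferInstanceAs (Algebra ℂ (MonoidAlgebra ℂ (FreeMonoid (Fin 2 × Bool))))

/-- The monomial `c · w`. -/
def mono (w : FreeMonoid (Fin 2 × Bool)) (c : ℂ) : CuntzPoly := MonoidAlgebra.single w c

/-- The generator `s i` of the free ⋆-algebra. -/
def gen (i : Fin 2) : CuntzPoly := mono (FreeMonoid.of (i, false)) 1

/-- The adjoint of a word: reverse it and exchange every generator with its adjoint. -/
def adjWord (w : FreeMonoid (Fin 2 × Bool)) : FreeMonoid (Fin 2 × Bool) :=
  FreeMonoid.ofList ((w.toList.map fun l => (l.1, !l.2)).reverse)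

theorem adjWord_mul (v w : FreeMonoid (Fin 2 × Bool)) :
    adjWord (v * w) = adjWord w * adjWord v := by
  simp [adjWord]

theorem adjWord_adjWord (w : FreeMonoid (Fin 2 × Bool)) : adjWord (adjWord w) = w := by
  simp [adjWord, Function.comp_def]

theorem mono_mul (v w : FreeMonoid (Fin 2 × Bool)) (c d : ℂ) :
    mono v c * mono w d = mono (v * w) (c * d) :=
  MonoidAlgebra.single_mul_single ..

theorem smul_mono (w : FreeMonoid (Fin 2 × Bool)) (c d : ℂ) :
    c • mono w d = mono w (c * d) :=
  MonoidAlgebra.smul_single ..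

theorem one_def : (1 : CuntzPoly) = mono 1 1 := rfl

theorem induction {P : CuntzPoly → Prop} (x : CuntzPoly) (h0 : P 0)
    (ha : ∀ x y, P x → P y → P (x + y)) (hm : ∀ w c, P (mono w c)) : P x :=
  MonoidAlgebra.induction_linear x h0 ha hm

/-- The conjugate-linear involution determined by the adjoint of words. -/
def starFun (x : CuntzPoly) : CuntzPoly :=
  MonoidAlgebra.mapDomain adjWord (MonoidAlgebra.map (starRingEnd ℂ : ℂ →+ ℂ) x)

theorem starFun_mono (w : FreeMonoid (Fin 2 × Bool)) (c : ℂ) :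
    starFun (mono w c) = mono (adjWord w) (star c) := by
  rw [starFun, mono, MonoidAlgebra.map_single, MonoidAlgebra.mapDomain_single]
  rfl

theorem starFun_zero : starFun 0 = 0 :=
  (congrArg (MonoidAlgebra.mapDomain adjWord) (MonoidAlgebra.map_zero _)).trans
    (MonoidAlgebra.mapDomain_zero _)

theorem starFun_add (x y : CuntzPoly) : starFun (x + y) = starFun x + starFun y :=
  (congrArg (MonoidAlgebra.mapDomain adjWord) (MonoidAlgebra.map_add _ _ _)).trans
    (MonoidAlgebra.mapDomain_add _ _ _)

instance : StarRing CuntzPoly where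
  star := starFun
  star_involutive x := by
    induction x using induction with
    | h0 => rw [starFun_zero, starFun_zero]
    | ha x y hx hy => rw [starFun_add, starFun_add, hx, hy]
    | hm w c => rw [starFun_mono, starFun_mono, adjWord_adjWord, star_star]
  star_add := starFun_add
  star_mul x y := by
    induction x using induction with
    | h0 => rw [zero_mul, starFun_zero, mul_zero]
    | ha x x' hx hx' => rw [add_mul, starFun_add, starFun_add, hx, hx', mul_add]
    | hm v c =>
      induction y using induction with
      | h0 => rw [mul_zero, starFun_zero, zero_mul]
      | ha y y' hy hy' => rw [mul_add, starFun_add, starFun_add, hy, hy', add_mul]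
      | hm w d =>
        rw [mono_mul, starFun_mono, starFun_mono, starFun_mono, mono_mul, adjWord_mul, star_mul]

theorem star_mono (w : FreeMonoid (Fin 2 × Bool)) (c : ℂ) :
    star (mono w c) = mono (adjWord w) (star c) := starFun_mono w c

instance : StarModule ℂ CuntzPoly where
  star_smul c x := by
    induction x using induction with
    | h0 => simp
    | ha x y hx hy => rw [smul_add, star_add, star_add, hx, hy, smul_add]
    | hm w d => rw [smul_mono, star_mono, star_mono, smul_mono, star_mul, mul_comm]

end CuntzPoly

/-- A Cuntz pair: isometries `t 0`, `t 1` with `t 0 * star (t 0) + t 1 * star (t 1) = 1`. -/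
structure IsCuntzPair {B : Type*} [Ring B] [StarRing B] (t : Fin 2 → B) : Prop where
  isometry : ∀ i, star (t i) * t i = 1
  sum_range : t 0 * star (t 0) + t 1 * star (t 1) = 1

/-- C⋆-seminorms on the free ⋆-algebra that vanish on the Cuntz relations. -/
structure IsCuntzSeminorm (p : CuntzPoly → ℝ) : Prop where
  add_le : ∀ x y, p (x + y) ≤ p x + p y
  smul : ∀ (c : ℂ) x, p (c • x) = ‖c‖ * p x
  mul_le : ∀ x y, p (x * y) ≤ p x * p y
  star_mul_self : ∀ x, p (star x * x) = p x * p x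
  isometry : ∀ i, p (star (CuntzPoly.gen i) * CuntzPoly.gen i - 1) = 0
  sum_range : p (CuntzPoly.gen 0 * star (CuntzPoly.gen 0)
    + CuntzPoly.gen 1 * star (CuntzPoly.gen 1) - 1) = 0

namespace IsCuntzSeminorm

variable {p : CuntzPoly → ℝ}

theorem map_zero (hp : IsCuntzSeminorm p) : p 0 = 0 := by
  have := hp.smul 0 0
  simpa using this

theorem map_neg (hp : IsCuntzSeminorm p) (x : CuntzPoly) : p (-x) = p x := by
  have := hp.smul (-1) x
  simpa using this

theorem nonneg (hp : IsCuntzSeminorm p) (x : CuntzPoly) : 0 ≤ p x := by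
  have := hp.add_le x (-x)
  rw [add_neg_cancel, hp.map_zero, hp.map_neg] at this
  linarith

theorem map_one_le (hp : IsCuntzSeminorm p) : p 1 ≤ 1 := by
  have := hp.star_mul_self 1
  rw [star_one, one_mul] at this
  nlinarith [hp.nonneg 1]

theorem le_map_star (hp : IsCuntzSeminorm p) (x : CuntzPoly) : p x ≤ p (star x) := by
  have h1 := hp.star_mul_self x
  have h2 := hp.mul_le (star x) x
  rcases (hp.nonneg x).eq_or_lt with h | h
  · rw [← h]; exact hp.nonneg _
  · rw [h1] at h2
    exact le_of_mul_le_mul_right h2 h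

theorem map_star (hp : IsCuntzSeminorm p) (x : CuntzPoly) : p (star x) = p x :=
  le_antisymm (by simpa using hp.le_map_star (star x)) (hp.le_map_star x)

theorem map_gen_le (hp : IsCuntzSeminorm p) (i : Fin 2) : p (CuntzPoly.gen i) ≤ 1 := by
  have h1 := hp.star_mul_self (CuntzPoly.gen i)
  have h2 := hp.add_le (star (CuntzPoly.gen i) * CuntzPoly.gen i - 1) 1
  rw [sub_add_cancel, hp.isometry, h1] at h2
  nlinarith [hp.nonneg (CuntzPoly.gen i), hp.map_one_le]

theorem map_letter_le (hp : IsCuntzSeminorm p) (l : Fin 2 × Bool) : p (CuntzPoly.mono (FreeMonoid.of l) 1) ≤ 1 := by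
  obtain ⟨i, b⟩ := l
  cases b with
  | false => exact hp.map_gen_le i
  | true =>
    have : CuntzPoly.mono (FreeMonoid.of (i, true)) 1 = star (CuntzPoly.gen i) := by
      rw [CuntzPoly.gen, CuntzPoly.star_mono, star_one]
      rfl
    rw [this, hp.map_star]
    exact hp.map_gen_le i

theorem map_word_le (hp : IsCuntzSeminorm p) (w : FreeMonoid (Fin 2 × Bool)) : p (CuntzPoly.mono w 1) ≤ 1 := by
  induction w using FreeMonoid.inductionOn' with
  | one => exact hp.map_one_le
  | of_mul l w hw =>
    have : CuntzPoly.mono (FreeMonoid.of l * w) 1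
        = CuntzPoly.mono (FreeMonoid.of l) 1 * CuntzPoly.mono w 1 := by
      rw [CuntzPoly.mono_mul, one_mul]
    rw [this]
    exact (hp.mul_le _ _).trans
      (mul_le_one₀ (hp.map_letter_le l) (hp.nonneg _) hw)

end IsCuntzSeminorm

namespace CuntzPoly

theorem exists_bound (x : CuntzPoly) : ∃ C : ℝ, ∀ p, IsCuntzSeminorm p → p x ≤ C := by
  induction x using induction with
  | h0 => exact ⟨0, fun p hp => hp.map_zero.le⟩
  | ha x y hx hy =>
    obtain ⟨C, hC⟩ := hx
    obtain ⟨D, hD⟩ := hy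
    exact ⟨C + D, fun p hp => (hp.add_le x y).trans (add_le_add (hC p hp) (hD p hp))⟩
  | hm w c =>
    refine ⟨‖c‖, fun p hp => ?_⟩
    have : mono w c = c • mono w 1 := by rw [smul_mono, mul_one]
    rw [this, hp.smul]
    exact mul_le_of_le_one_right (norm_nonneg c) (hp.map_word_le w)

/-- The universal seminorm: the supremum of all C⋆-seminorms vanishing on the Cuntz relations. -/
def univNorm (x : CuntzPoly) : ℝ := ⨆ p : {p : CuntzPoly → ℝ // IsCuntzSeminorm p}, p.1 x

theorem isCuntzSeminorm_zero : IsCuntzSeminorm fun _ => 0 := by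
  constructor <;> simp

instance : Nonempty {p : CuntzPoly → ℝ // IsCuntzSeminorm p} := ⟨⟨_, isCuntzSeminorm_zero⟩⟩

theorem le_univNorm {p : CuntzPoly → ℝ} (hp : IsCuntzSeminorm p) (x : CuntzPoly) :
    p x ≤ univNorm x := by
  obtain ⟨C, hC⟩ := exists_bound x
  exact le_ciSup (f := fun p : {p : CuntzPoly → ℝ // IsCuntzSeminorm p} => p.1 x)
    ⟨C, by rintro _ ⟨q, rfl⟩; exact hC q.1 q.2⟩ ⟨p, hp⟩

theorem univNorm_le {x : CuntzPoly} {C : ℝ} (h : ∀ p, IsCuntzSeminorm p → p x ≤ C) :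
    univNorm x ≤ C :=
  ciSup_le fun p => h p.1 p.2

theorem univNorm_nonneg (x : CuntzPoly) : 0 ≤ univNorm x := le_univNorm isCuntzSeminorm_zero x

theorem isCuntzSeminorm_univNorm : IsCuntzSeminorm univNorm where
  add_le x y := univNorm_le fun p hp =>
    (hp.add_le x y).trans (add_le_add (le_univNorm hp x) (le_univNorm hp y))
  smul c x := by
    refine le_antisymm (univNorm_le fun p hp => ?_) ?_
    · rw [hp.smul]
      exact mul_le_mul_of_nonneg_left (le_univNorm hp x) (norm_nonneg c)
    · rw [univNorm, Real.mul_iSup_of_nonneg (norm_nonneg c)]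
      refine ciSup_le fun p => ?_
      rw [← p.2.smul]
      exact le_univNorm p.2 _
  mul_le x y := univNorm_le fun p hp => (hp.mul_le x y).trans
    (mul_le_mul (le_univNorm hp x) (le_univNorm hp y) (hp.nonneg y) (univNorm_nonneg x))
  star_mul_self x := by
    refine le_antisymm (univNorm_le fun p hp => ?_) ?_
    · rw [hp.star_mul_self]
      exact mul_self_le_mul_self (hp.nonneg x) (le_univNorm hp x)
    · have : univNorm x ≤ √(univNorm (star x * x)) := univNorm_le fun p hp => by
        refine Real.le_sqrt_of_sq_le ?_
        rw [sq, ← hp.star_mul_self]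
        exact le_univNorm hp _
      calc univNorm x * univNorm x
          ≤ √(univNorm (star x * x)) * √(univNorm (star x * x)) :=
            mul_self_le_mul_self (univNorm_nonneg x) this
        _ = univNorm (star x * x) := Real.mul_self_sqrt (univNorm_nonneg _)
  isometry i := le_antisymm (univNorm_le fun p hp => (hp.isometry i).le) (univNorm_nonneg _)
  sum_range := le_antisymm (univNorm_le fun p hp => hp.sum_range.le) (univNorm_nonneg _)

instance : SeminormedRing CuntzPoly :=
  RingSeminorm.toSeminormedRing
    { toFun := univNorm
      map_zero' := isCuntzSeminorm_univNorm.map_zero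
      add_le' := isCuntzSeminorm_univNorm.add_le
      neg' := isCuntzSeminorm_univNorm.map_neg
      mul_le' := isCuntzSeminorm_univNorm.mul_le }

theorem norm_def (x : CuntzPoly) : ‖x‖ = univNorm x := rfl

instance : NormedAlgebra ℂ CuntzPoly where
  norm_smul_le c x := (isCuntzSeminorm_univNorm.smul c x).le

instance : NormedStarGroup CuntzPoly where
  norm_star_le x := (isCuntzSeminorm_univNorm.map_star x).le

end CuntzPoly

/-- The (Hausdorff) completion of the free ⋆-algebra in the universal seminorm. -/
abbrev CuntzCompletion : Type := UniformSpace.Completion CuntzPoly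

namespace CuntzCompletion

open UniformSpace

instance : NormedAlgebra ℂ CuntzCompletion where
  norm_smul_le c x := norm_smul_le c x

instance : Star CuntzCompletion := ⟨Completion.map (star : CuntzPoly → CuntzPoly)⟩

theorem continuous_star' : Continuous (star : CuntzCompletion → CuntzCompletion) :=
  Completion.continuous_map

theorem star_coe (x : CuntzPoly) : star (x : CuntzCompletion) = ((star x : CuntzPoly) : CuntzCompletion) :=
  Completion.map_coe (f := (star : CuntzPoly → CuntzPoly))
    (starNormedAddGroupHom (E := CuntzPoly)).uniformContinuous x

instance : StarRing CuntzCompletion where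
  star_involutive x := by
    induction x using Completion.induction_on with
    | hp => exact isClosed_eq (continuous_star'.comp continuous_star') continuous_id
    | ih x => rw [star_coe, star_coe, star_star]
  star_add x y := by
    induction x, y using Completion.induction_on₂ with
    | hp =>
      exact isClosed_eq (continuous_star'.comp (continuous_fst.add continuous_snd))
        ((continuous_star'.comp continuous_fst).add (continuous_star'.comp continuous_snd))
    | ih x y => rw [← Completion.coe_add, star_coe, star_add, Completion.coe_add, star_coe, star_coe]
  star_mul x y := by
    induction x, y using Completion.induction_on₂ with
    | hp =>
      exact isClosed_eq (continuous_star'.comp (continuous_fst.mul continuous_snd))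
        ((continuous_star'.comp continuous_snd).mul (continuous_star'.comp continuous_fst))
    | ih x y => rw [← Completion.coe_mul, star_coe, star_mul, Completion.coe_mul, star_coe, star_coe]

instance : StarModule ℂ CuntzCompletion where
  star_smul c x := by
    induction x using Completion.induction_on with
    | hp =>
      exact isClosed_eq (continuous_star'.comp (continuous_const_smul c))
        (continuous_star'.const_smul (star c))
    | ih x => rw [← Completion.coe_smul, star_coe, star_smul, Completion.coe_smul, star_coe]

instance : CStarRing CuntzCompletion where
  norm_mul_self_le x := by
    refine le_of_eq ?_
    induction x using Completion.induction_on with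
    | hp => exact isClosed_eq (by fun_prop) (by have := continuous_star'; fun_prop)
    | ih x =>
      rw [star_coe, ← Completion.coe_mul, Completion.norm_coe, Completion.norm_coe]
      exact (CuntzPoly.isCuntzSeminorm_univNorm.star_mul_self x).symm

instance : CStarAlgebra CuntzCompletion where

/-- The images of the two generators. -/
def s (i : Fin 2) : CuntzCompletion := (CuntzPoly.gen i : CuntzCompletion)

theorem coe_eq_zero {x : CuntzPoly} (h : CuntzPoly.univNorm x = 0) : (x : CuntzCompletion) = 0 := by
  rw [← norm_eq_zero, Completion.norm_coe]
  exact h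

theorem isCuntzPair_s : IsCuntzPair s where
  isometry i := by
    have := coe_eq_zero (CuntzPoly.isCuntzSeminorm_univNorm.isometry i)
    rwa [Completion.coe_sub, Completion.coe_mul, ← star_coe, Completion.coe_one, sub_eq_zero] at this
  sum_range := by
    have := coe_eq_zero CuntzPoly.isCuntzSeminorm_univNorm.sum_range
    rwa [Completion.coe_sub, Completion.coe_add, Completion.coe_mul, Completion.coe_mul,
      ← star_coe, ← star_coe, Completion.coe_one, sub_eq_zero] at this

section Universal

variable {B : Type*} [CStarAlgebra B]

/-- Evaluation of noncommutative ⋆-polynomials at a pair of elements of a C⋆-algebra. -/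
def eval (t : Fin 2 → B) : CuntzPoly →ₐ[ℂ] B :=
  MonoidAlgebra.lift ℂ B (FreeMonoid (Fin 2 × Bool))
    (FreeMonoid.lift fun l => bif l.2 then star (t l.1) else t l.1)

theorem eval_mono (t : Fin 2 → B) (w : FreeMonoid (Fin 2 × Bool)) (c : ℂ) :
    eval t (CuntzPoly.mono w c)
      = c • FreeMonoid.lift (fun l : Fin 2 × Bool => bif l.2 then star (t l.1) else t l.1) w :=
  MonoidAlgebra.lift_single ..

theorem eval_gen (t : Fin 2 → B) (i : Fin 2) : eval t (CuntzPoly.gen i) = t i := by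
  rw [CuntzPoly.gen, eval_mono]
  simp

theorem lift_adjWord (t : Fin 2 → B) (w : FreeMonoid (Fin 2 × Bool)) :
    FreeMonoid.lift (fun l : Fin 2 × Bool => bif l.2 then star (t l.1) else t l.1)
        (CuntzPoly.adjWord w)
      = star (FreeMonoid.lift (fun l : Fin 2 × Bool => bif l.2 then star (t l.1) else t l.1) w) := by
  induction w using FreeMonoid.inductionOn' with
  | one => simp [CuntzPoly.adjWord]
  | of_mul l w hw =>
    rw [CuntzPoly.adjWord_mul, map_mul, hw, map_mul, star_mul]
    congr 1
    obtain ⟨i, b⟩ := l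
    cases b <;> simp [CuntzPoly.adjWord]

theorem eval_star (t : Fin 2 → B) (x : CuntzPoly) : eval t (star x) = star (eval t x) := by
  induction x using CuntzPoly.induction with
  | h0 => simp
  | ha x y hx hy => rw [star_add, map_add, hx, hy, map_add, star_add]
  | hm w c => rw [CuntzPoly.star_mono, eval_mono, eval_mono, lift_adjWord, star_smul]

theorem isCuntzSeminorm_eval {t : Fin 2 → B} (ht : IsCuntzPair t) :
    IsCuntzSeminorm fun x => ‖eval t x‖ where
  add_le x y := by rw [map_add]; exact norm_add_le _ _
  smul c x := by rw [map_smul, norm_smul]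
  mul_le x y := by rw [map_mul]; exact norm_mul_le _ _
  star_mul_self x := by rw [map_mul, eval_star, CStarRing.norm_star_mul_self]
  isometry i := by
    rw [map_sub, map_mul, eval_star, eval_gen, ht.isometry, map_one, sub_self, norm_zero]
  sum_range := by
    rw [map_sub, map_add, map_mul, map_mul, eval_star, eval_star, eval_gen, eval_gen, ht.sum_range,
      map_one, sub_self, norm_zero]

theorem continuous_eval {t : Fin 2 → B} (ht : IsCuntzPair t) : Continuous (eval t) :=
  AddMonoidHomClass.continuous_of_bound (eval t) 1 fun x => by
    rw [one_mul]
    exact CuntzPoly.le_univNorm (isCuntzSeminorm_eval ht) x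

/-- The unital ⋆-homomorphism determined by a Cuntz pair. -/
def lift (t : Fin 2 → B) (ht : IsCuntzPair t) : CuntzCompletion →⋆ₐ[ℂ] B where
  toRingHom := Completion.extensionHom (eval t : CuntzPoly →+* B) (continuous_eval ht)
  commutes' c := by
    refine (Completion.extensionHom_coe (eval t : CuntzPoly →+* B) (continuous_eval ht) _).trans ?_
    exact (eval t).commutes c
  map_star' x := by
    change Completion.extensionHom (eval t : CuntzPoly →+* B) (continuous_eval ht) (star x)
      = star (Completion.extensionHom (eval t : CuntzPoly →+* B) (continuous_eval ht) x)
    induction x using Completion.induction_on with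
    | hp =>
      exact isClosed_eq (Completion.continuous_extension.comp continuous_star')
        (continuous_star.comp Completion.continuous_extension)
    | ih x =>
      rw [star_coe]
      exact (Completion.extensionHom_coe (eval t : CuntzPoly →+* B) (continuous_eval ht) _).trans
        ((eval_star t x).trans (congrArg star (Completion.extensionHom_coe
          (eval t : CuntzPoly →+* B) (continuous_eval ht) x).symm))

theorem lift_coe (t : Fin 2 → B) (ht : IsCuntzPair t) (x : CuntzPoly) :
    lift t ht (x : CuntzCompletion) = eval t x :=
  Completion.extensionHom_coe (eval t : CuntzPoly →+* B) (continuous_eval ht) x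

theorem lift_s (t : Fin 2 → B) (ht : IsCuntzPair t) (i : Fin 2) : lift t ht (s i) = t i :=
  (lift_coe t ht _).trans (eval_gen t i)

theorem hom_ext {φ ψ : CuntzCompletion →⋆ₐ[ℂ] B} (h : ∀ i, φ (s i) = ψ (s i)) : φ = ψ := by
  have key : ∀ (χ : CuntzCompletion →⋆ₐ[ℂ] B) (x : CuntzPoly),
      χ (x : CuntzCompletion) = eval (fun i => χ (s i)) x := by
    intro χ x
    induction x using CuntzPoly.induction with
    | h0 => rw [Completion.coe_zero, map_zero, map_zero]
    | ha x y hx hy => rw [Completion.coe_add, map_add, map_add, hx, hy]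
    | hm w c =>
      have h1 : CuntzPoly.mono w c = c • CuntzPoly.mono w 1 := by
        rw [CuntzPoly.smul_mono, mul_one]
      rw [h1, Completion.coe_smul, map_smul, map_smul]
      congr 1
      induction w using FreeMonoid.inductionOn' with
      | one => rw [← CuntzPoly.one_def, Completion.coe_one, map_one, map_one]
      | of_mul l w hw =>
        have h2 : CuntzPoly.mono (FreeMonoid.of l * w) 1
            = CuntzPoly.mono (FreeMonoid.of l) 1 * CuntzPoly.mono w 1 := by
          rw [CuntzPoly.mono_mul, one_mul]
        rw [h2, Completion.coe_mul, map_mul, map_mul, hw (by rw [CuntzPoly.smul_mono, mul_one])]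
        congr 1
        obtain ⟨i, b⟩ := l
        cases b with
        | false => exact (eval_gen (fun i => χ (s i)) i).symm
        | true =>
          have h3 : CuntzPoly.mono (FreeMonoid.of (i, true)) 1 = star (CuntzPoly.gen i) := by
            rw [CuntzPoly.gen, CuntzPoly.star_mono, star_one]
            rfl
          rw [h3, ← star_coe, map_star, eval_star, eval_gen]
          rfl
  ext x
  induction x using Completion.induction_on with
  | hp => exact isClosed_eq (map_continuous φ) (map_continuous ψ)
  | ih x => rw [key, key, funext h]

end Universal

end CuntzCompletion

/-- The Cuntz algebra `𝒪₂`: the universal unital C⋆-algebra generated by a Cuntz pair. -/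
def CuntzAlgebra : Type := CuntzCompletion

namespace CuntzAlgebra

instance : CStarAlgebra CuntzAlgebra := inferInstanceAs (CStarAlgebra CuntzCompletion)

instance : PartialOrder CuntzAlgebra := CStarAlgebra.spectralOrder _

instance : StarOrderedRing CuntzAlgebra := CStarAlgebra.spectralOrderedRing _

/-- The generating isometries of `𝒪₂`. -/
def s (i : Fin 2) : CuntzAlgebra := CuntzCompletion.s i

theorem isCuntzPair_s : IsCuntzPair s where
  isometry := CuntzCompletion.isCuntzPair_s.isometry
  sum_range := CuntzCompletion.isCuntzPair_s.sum_range

/-- The universal property of `𝒪₂`: every Cuntz pair in a unital C⋆-algebra is the image of the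
generators under a unital ⋆-homomorphism. -/
def lift {B : Type*} [CStarAlgebra B] (t : Fin 2 → B) (ht : IsCuntzPair t) :
    CuntzAlgebra →⋆ₐ[ℂ] B :=
  CuntzCompletion.lift t ht

theorem lift_s {B : Type*} [CStarAlgebra B] (t : Fin 2 → B) (ht : IsCuntzPair t) (i : Fin 2) :
    lift t ht (s i) = t i :=
  CuntzCompletion.lift_s t ht i

/-- Uniqueness in the universal property: `𝒪₂` is generated by `s 0` and `s 1`. -/
theorem hom_ext {B : Type*} [CStarAlgebra B] {φ ψ : CuntzAlgebra →⋆ₐ[ℂ] B}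
    (h : ∀ i, φ (s i) = ψ (s i)) : φ = ψ :=
  CuntzCompletion.hom_ext (φ := φ) (ψ := ψ) h

theorem isCuntzPair_swap : IsCuntzPair fun i => s (Equiv.swap 0 1 i) where
  isometry i := isCuntzPair_s.isometry _
  sum_range := by
    simpa [add_comm] using isCuntzPair_s.sum_range

/-- The flip of `𝒪₂` as an endomorphism: it exchanges the generators. -/
def flipHom : CuntzAlgebra →⋆ₐ[ℂ] CuntzAlgebra := lift _ isCuntzPair_swap

theorem flipHom_s (i : Fin 2) : flipHom (s i) = s (Equiv.swap 0 1 i) := lift_s _ _ i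

theorem flipHom_comp_flipHom : flipHom.comp flipHom = StarAlgHom.id ℂ CuntzAlgebra :=
  hom_ext fun i => by
    rw [StarAlgHom.comp_apply, flipHom_s, flipHom_s, Equiv.swap_apply_self]
    rfl

/-- The flip automorphism of `𝒪₂`, exchanging `s 0` and `s 1`. -/
def flip : CuntzAlgebra ≃⋆ₐ[ℂ] CuntzAlgebra :=
  StarAlgEquiv.ofStarAlgHom flipHom flipHom flipHom_comp_flipHom flipHom_comp_flipHom

theorem flip_s (i : Fin 2) : flip (s i) = s (Equiv.swap 0 1 i) := flipHom_s i

theorem flip_mul_flip : flip * flip = 1 := by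
  ext x
  exact DFunLike.congr_fun flipHom_comp_flipHom x

/-- The flip action of `ℤ/2` on `𝒪₂`. -/
def flipAction : Multiplicative (ZMod 2) →* (CuntzAlgebra ≃⋆ₐ[ℂ] CuntzAlgebra) where
  toFun g := if g = 1 then 1 else flip
  map_one' := if_pos rfl
  map_mul' := by
    have h : ∀ g : Multiplicative (ZMod 2), g = 1 ∨ g = Multiplicative.ofAdd 1 := by decide
    have h1 : Multiplicative.ofAdd (1 : ZMod 2) ≠ 1 := by decide
    have h2 : Multiplicative.ofAdd (1 : ZMod 2) * Multiplicative.ofAdd 1 = 1 := by decide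
    intro g k
    rcases h g with rfl | rfl <;> rcases h k with rfl | rfl <;> simp [h1, h2, flip_mul_flip]

end CuntzAlgebra

/-! ## Crossed products by finite groups -/

section CrossedProduct

variable {A : Type*} [CStarAlgebra A] [PartialOrder A] [StarOrderedRing A]
  {G : Type*} [Group G] [Fintype G] [DecidableEq G] (α : G →* (A ≃⋆ₐ[ℂ] A))

/-- The copy of `A` in the regular representation on `ℓ²(G) ⊗ A`: `a` acts as the diagonal matrix
with entries `α h⁻¹ a`. -/
def regularCoeff (a : A) : CStarMatrix G G A :=
  CStarMatrix.ofMatrix (Matrix.diagonal fun h => α h⁻¹ a)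

/-- The copy of `G` in the regular representation on `ℓ²(G) ⊗ A`: `g` sends `δ_t` to `δ_{gt}`. -/
def regularTranslation (A : Type*) [CStarAlgebra A] (g : G) : CStarMatrix G G A :=
  CStarMatrix.ofMatrix (Matrix.of fun s t => if s = g * t then 1 else 0)

theorem regularCoeff_apply (a : A) (s t : G) :
    regularCoeff α a s t = if s = t then α s⁻¹ a else 0 :=
  Matrix.diagonal_apply ..

theorem regularTranslation_apply (g s t : G) :
    regularTranslation A g s t = if s = g * t then 1 else 0 := rfl

/-- The C⋆-subalgebra of `B(ℓ²(G) ⊗ A) = M_G(A)` generated by the regular representation. -/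
def crossedProductSubalgebra : StarSubalgebra ℂ (CStarMatrix G G A) :=
  (StarAlgebra.adjoin ℂ
    (Set.range (regularCoeff α) ∪ Set.range (regularTranslation A))).topologicalClosure

instance : IsClosed (crossedProductSubalgebra α : Set (CStarMatrix G G A)) :=
  StarSubalgebra.isClosed_topologicalClosure _

/-- The crossed product `A ⋊ G` of a unital C⋆-algebra by an action of a finite group (for which the
full and the reduced crossed product coincide; see `CrossedProduct.existsUnique_lift` for the
universal property). -/
def CrossedProduct : Type _ := crossedProductSubalgebra α

namespace CrossedProduct

instance : CStarAlgebra (CrossedProduct α) :=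
  inferInstanceAs (CStarAlgebra (crossedProductSubalgebra α))

instance : PartialOrder (CrossedProduct α) := CStarAlgebra.spectralOrder _

instance : StarOrderedRing (CrossedProduct α) := CStarAlgebra.spectralOrderedRing _

/-- The inclusion `A ⊆ A ⋊ G`. -/
def incl : A →⋆ₐ[ℂ] CrossedProduct α where
  toFun a := ⟨regularCoeff α a, StarSubalgebra.le_topologicalClosure _
    (StarAlgebra.subset_adjoin ℂ _ (Or.inl ⟨a, rfl⟩))⟩
  map_one' := by
    refine Subtype.ext (CStarMatrix.ext fun s t => ?_)
    change regularCoeff α 1 s t = (1 : CStarMatrix G G A) s t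
    rw [regularCoeff_apply, map_one, CStarMatrix.one_apply]
  map_mul' a b := by
    refine Subtype.ext (CStarMatrix.ext fun s t => ?_)
    change regularCoeff α (a * b) s t = (regularCoeff α a * regularCoeff α b) s t
    rw [CStarMatrix.mul_apply, Finset.sum_eq_single s]
    · simp only [regularCoeff_apply, map_mul]
      split_ifs <;> simp
    · intro r _ hr
      rw [regularCoeff_apply, if_neg (Ne.symm hr), zero_mul]
    · simp
  map_zero' := by
    refine Subtype.ext (CStarMatrix.ext fun s t => ?_)
    change regularCoeff α 0 s t = 0
    rw [regularCoeff_apply, map_zero, ite_self]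
  map_add' a b := by
    refine Subtype.ext (CStarMatrix.ext fun s t => ?_)
    change regularCoeff α (a + b) s t = regularCoeff α a s t + regularCoeff α b s t
    simp only [regularCoeff_apply, map_add]
    split_ifs <;> simp
  commutes' c := by
    refine Subtype.ext (CStarMatrix.ext fun s t => ?_)
    change regularCoeff α (algebraMap ℂ A c) s t = (algebraMap ℂ (CStarMatrix G G A) c) s t
    rw [regularCoeff_apply, CStarMatrix.algebraMap_apply, Algebra.algebraMap_eq_smul_one, map_smul,
      map_one]
  map_star' a := by
    refine Subtype.ext (CStarMatrix.ext fun s t => ?_)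
    change regularCoeff α (star a) s t = star (regularCoeff α a t s)
    simp only [regularCoeff_apply, map_star]
    split_ifs with h1 h2 h2
    · rw [h1]
    · exact absurd h1.symm h2
    · exact absurd h2.symm h1
    · simp

theorem incl_injective : Function.Injective (incl α) := by
  intro a b h
  have : regularCoeff α a 1 1 = regularCoeff α b 1 1 := by
    rw [show regularCoeff α a = regularCoeff α b from congrArg Subtype.val h]
  simpa [regularCoeff_apply] using this

/-- The canonical group elements of `A ⋊ G`. -/
def translation (g : G) : CrossedProduct α :=
  ⟨regularTranslation A g, StarSubalgebra.le_topologicalClosure _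
    (StarAlgebra.subset_adjoin ℂ _ (Or.inr ⟨g, rfl⟩))⟩

theorem translation_mul (g k : G) :
    translation α (g * k) = translation α g * translation α k := by
  refine Subtype.ext (CStarMatrix.ext fun s t => ?_)
  change regularTranslation A (g * k) s t = (regularTranslation A g * regularTranslation A k) s t
  rw [CStarMatrix.mul_apply, Finset.sum_eq_single (k * t)]
  · simp [regularTranslation_apply, mul_assoc]
  · intro r _ hr
    rw [regularTranslation_apply k, if_neg hr, mul_zero]
  · simp

theorem translation_one : translation α 1 = 1 := by
  refine Subtype.ext (CStarMatrix.ext fun s t => ?_)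
  change regularTranslation A 1 s t = (1 : CStarMatrix G G A) s t
  rw [regularTranslation_apply, CStarMatrix.one_apply, one_mul]

theorem star_translation (g : G) : star (translation α g) = translation α g⁻¹ := by
  refine Subtype.ext (CStarMatrix.ext fun s t => ?_)
  change star (regularTranslation A g t s) = regularTranslation A g⁻¹ s t
  rw [regularTranslation_apply, regularTranslation_apply]
  have : t = g * s ↔ s = g⁻¹ * t := by rw [eq_inv_mul_iff_mul_eq, eq_comm]
  simp only [this]
  split_ifs <;> simp

theorem translation_mul_incl (g : G) (a : A) :
    translation α g * incl α a = incl α (α g a) * translation α g := by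
  refine Subtype.ext (CStarMatrix.ext fun s t => ?_)
  change (regularTranslation A g * regularCoeff α a) s t
    = (regularCoeff α (α g a) * regularTranslation A g) s t
  rw [CStarMatrix.mul_apply, CStarMatrix.mul_apply, Finset.sum_eq_single t,
    Finset.sum_eq_single s]
  · simp only [regularTranslation_apply, regularCoeff_apply, if_true]
    split_ifs with h
    · rw [one_mul, mul_one, ← StarAlgEquiv.mul_apply, ← map_mul, h]
      simp
    · simp
  · intro r _ hr
    rw [regularCoeff_apply, if_neg (Ne.symm hr), zero_mul]
  · simp
  · intro r _ hr
    rw [regularCoeff_apply, if_neg hr, mul_zero]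
  · simp

/-- Elements of the crossed product are determined by their first row. -/
theorem apply_eq {M : CStarMatrix G G A} (hM : M ∈ crossedProductSubalgebra α) (s t : G) :
    M s t = α s⁻¹ (M 1 (t * s⁻¹)) := by
  have hc : ∀ s t : G, Continuous fun M : CStarMatrix G G A => M s t := fun s t =>
    (continuous_apply t).comp (continuous_apply (A := fun _ : G => G → A) s)
  have hclosed : IsClosed {M : CStarMatrix G G A | ∀ s t, M s t = α s⁻¹ (M 1 (t * s⁻¹))} := by
    simp only [Set.ofPred_forall]
    exact isClosed_iInter fun s => isClosed_iInter fun t =>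
      isClosed_eq (hc s t) ((map_continuous (α s⁻¹)).comp (hc 1 (t * s⁻¹)))
  refine closure_minimal (fun M hM => ?_) hclosed hM s t
  refine StarAlgebra.adjoin_induction
    (p := fun (M : CStarMatrix G G A) _ => ∀ s t : G, M s t = α s⁻¹ (M 1 (t * s⁻¹)))
    ?_ ?_ ?_ ?_ ?_ hM
  · rintro _ (⟨a, rfl⟩ | ⟨g, rfl⟩) s t
    · rw [regularCoeff_apply, regularCoeff_apply]
      by_cases h : s = t
      · simp [h]
      · have : (1 : G) ≠ t * s⁻¹ := fun h' => h (by rw [eq_mul_inv_iff_mul_eq, one_mul] at h'; exact h')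
        rw [if_neg h, if_neg this, map_zero]
    · rw [regularTranslation_apply, regularTranslation_apply]
      have : (1 = g * (t * s⁻¹)) ↔ s = g * t := by
        rw [← mul_assoc, eq_mul_inv_iff_mul_eq, one_mul]
      simp only [this]
      split_ifs <;> simp
  · intro c s t
    rw [CStarMatrix.algebraMap_apply, CStarMatrix.algebraMap_apply]
    have : ((1 : G) = t * s⁻¹) ↔ s = t := by rw [eq_mul_inv_iff_mul_eq, one_mul]
    simp only [this, Algebra.algebraMap_eq_smul_one]
    split_ifs <;> simp
  · intro M N _ _ hM hN s t
    rw [CStarMatrix.add_apply, CStarMatrix.add_apply, map_add, ← hM, ← hN]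
  · intro M N _ _ hM hN s t
    rw [CStarMatrix.mul_apply, CStarMatrix.mul_apply, map_sum]
    refine (Fintype.sum_equiv (Equiv.mulRight s) _ _ fun r => ?_).symm
    rw [Equiv.coe_mulRight, map_mul, hM s (r * s), mul_inv_cancel_right, hN r, hN (r * s),
      mul_inv_rev, map_mul α s⁻¹ r⁻¹, mul_assoc t]
    rfl
  · intro M _ hM s t
    rw [CStarMatrix.star_apply, CStarMatrix.star_apply, map_star, hM t s, hM (t * s⁻¹) 1,
      mul_inv_rev, inv_inv, one_mul, ← StarAlgEquiv.mul_apply, ← map_mul, inv_mul_cancel_left]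

theorem mul_val_apply (x y : CrossedProduct α) (t : G) :
    (x * y).1 1 t = ∑ r, x.1 1 r * α r⁻¹ (y.1 1 (t * r⁻¹)) :=
  (CStarMatrix.mul_apply (M := x.1) (N := y.1)).trans
    (Finset.sum_congr rfl fun r _ => by rw [apply_eq α y.2 r t])

theorem star_val_apply (x : CrossedProduct α) (t : G) :
    (star x).1 1 t = star (α t⁻¹ (x.1 1 t⁻¹)) := by
  rw [show (star x).1 1 t = star (x.1 t 1) from rfl, apply_eq α x.2 t 1, one_mul]

theorem incl_val_apply (a : A) (t : G) : (incl α a).1 1 t = if 1 = t then a else 0 := by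
  rw [show (incl α a).1 = regularCoeff α a from rfl, regularCoeff_apply, inv_one, map_one]
  rfl

theorem translation_val_apply (g t : G) : (translation α g).1 1 t = if 1 = g * t then 1 else 0 := rfl

theorem eq_sum (x : CrossedProduct α) : x = ∑ g, incl α (x.1 1 g⁻¹) * translation α g := by
  have hval : ∀ f : G → CrossedProduct α, (∑ g, f g).1 = ∑ g, (f g).1 := fun f =>
    map_sum (crossedProductSubalgebra α).subtype f Finset.univ
  have hrow : ∀ (f : G → CStarMatrix G G A) (s t : G), (∑ g, f g) s t = ∑ g, f g s t := by
    intro f s t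
    exact (congrFun (Finset.sum_apply s Finset.univ (fun g => (f g : G → G → A))) t).trans
      (Finset.sum_apply t Finset.univ _)
  refine Subtype.ext (CStarMatrix.ext fun s t => ?_)
  rw [apply_eq α x.2 s t,
    apply_eq α (∑ g, incl α (x.1 1 g⁻¹) * translation α g : CrossedProduct α).2 s t]
  congr 1
  generalize t * s⁻¹ = r
  refine Eq.trans ?_ (congrFun (congrFun (hval _) 1) r).symm
  rw [hrow, Finset.sum_eq_single r⁻¹]
  · rw [mul_val_apply, Finset.sum_eq_single 1]
    · rw [incl_val_apply, translation_val_apply]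
      simp
    · intro k _ hk
      rw [incl_val_apply, if_neg (Ne.symm hk), zero_mul]
    · simp
  · intro g _ hg
    rw [mul_val_apply]
    refine Finset.sum_eq_zero fun k _ => ?_
    rw [incl_val_apply, translation_val_apply]
    split_ifs with h1 h2
    · subst h1
      rw [inv_one, mul_one] at h2
      exact absurd (eq_inv_of_mul_eq_one_left h2.symm) hg
    · rw [map_zero, mul_zero]
    · rw [zero_mul]
    · rw [zero_mul]
  · simp

/-- The universal property of `A ⋊ G`: every covariant representation `(ρ, u)` in a unital
C⋆-algebra factors uniquely through it. -/
theorem existsUnique_lift {B : Type*} [CStarAlgebra B] (ρ : A →⋆ₐ[ℂ] B) (u : G →* unitary B)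
    (h : ∀ g a, (u g : B) * ρ a = ρ (α g a) * u g) :
    ∃! Φ : CrossedProduct α →⋆ₐ[ℂ] B,
      (∀ a, Φ (incl α a) = ρ a) ∧ ∀ g, Φ (translation α g) = u g := by
  have hi : ∀ a, ∑ g, ρ ((incl α a).1 1 g⁻¹) * (u g : B) = ρ a := by
    intro a
    rw [Finset.sum_eq_single 1]
    · rw [incl_val_apply]
      simp
    · intro g _ hg
      rw [incl_val_apply, if_neg (fun h' => hg (by simpa using h'.symm)), map_zero, zero_mul]
    · simp
  refine ⟨⟨⟨⟨⟨⟨fun x => ∑ g, ρ (x.1 1 g⁻¹) * (u g : B), ?_⟩, ?_⟩, ?_, ?_⟩, ?_⟩, ?_⟩,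
    ⟨hi, ?_⟩, ?_⟩
  · have := hi 1
    rwa [map_one, map_one] at this
  · intro x y
    change ∑ g, ρ ((x * y).1 1 g⁻¹) * (u g : B)
      = (∑ g, ρ (x.1 1 g⁻¹) * (u g : B)) * ∑ g, ρ (y.1 1 g⁻¹) * (u g : B)
    simp only [mul_val_apply, map_sum, Finset.sum_mul, Finset.mul_sum]
    rw [Finset.sum_comm, ← Equiv.sum_comp (Equiv.inv G)]
    conv_rhs => rw [Finset.sum_comm]
    refine Finset.sum_congr rfl fun k _ => ?_
    rw [← Equiv.sum_comp (Equiv.mulLeft k)]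
    refine Finset.sum_congr rfl fun g _ => ?_
    simp only [Equiv.inv_apply, Equiv.coe_mulLeft, inv_inv, map_mul, Submonoid.coe_mul]
    rw [mul_inv_rev, inv_mul_cancel_right, mul_assoc, mul_assoc, ← mul_assoc _ (u k : B),
      ← h k, mul_assoc]
  · have := hi 0
    rwa [map_zero, map_zero] at this
  · intro x y
    change ∑ g, ρ (x.1 1 g⁻¹ + y.1 1 g⁻¹) * (u g : B) = _
    simp only [map_add, add_mul, Finset.sum_add_distrib]
  · intro c
    have := hi (algebraMap ℂ A c)
    rwa [AlgHomClass.commutes, AlgHomClass.commutes] at this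
  · intro x
    change ∑ g, ρ ((star x).1 1 g⁻¹) * (u g : B) = star (∑ g, ρ (x.1 1 g⁻¹) * (u g : B))
    rw [star_sum, ← Equiv.sum_comp (Equiv.inv G)]
    refine Finset.sum_congr rfl fun g _ => ?_
    rw [Equiv.inv_apply, star_val_apply, inv_inv, ← map_star, ← h, star_mul, map_star]
    simp only [map_inv]
    rfl
  · intro g
    change ∑ k, ρ ((translation α g).1 1 k⁻¹) * (u k : B) = u g
    rw [Finset.sum_eq_single g]
    · rw [translation_val_apply]
      simp
    · intro k _ hk
      rw [translation_val_apply, if_neg (fun h' => hk (mul_inv_eq_one.mp h'.symm).symm), map_zero,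
        zero_mul]
    · simp
  · rintro Ψ ⟨h1, h2⟩
    refine StarAlgHom.ext fun x => ?_
    conv_lhs => rw [eq_sum α x]
    simp only [map_sum, map_mul, h1, h2]
    rfl

end CrossedProduct

end CrossedProduct

/-! ## States, expectations, injective envelopes, irreducible representations -/

section Notions

variable (A : Type*) [CStarAlgebra A] [PartialOrder A]

/-- The states of a unital C⋆-algebra: positive functionals with value `1` at `1`. -/
def stateSpace : Set (A →L[ℂ] ℂ) := {φ | φ 1 = 1 ∧ ∀ a, 0 ≤ a → 0 ≤ φ a}

/-- The pure states: the extreme points of the state space. -/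
def pureStates : Set (A →L[ℂ] ℂ) := (stateSpace A).extremePoints ℝ

variable {A} {B : Type*} [CStarAlgebra B] [PartialOrder B]

/-- The pure extension property of the inclusion `i : A ⊆ B`: every pure state of `A` has exactly one
extension to a state of `B`. -/
def HasPureExtensionProperty (i : A →⋆ₐ[ℂ] B) : Prop :=
  ∀ φ ∈ pureStates A, ∃! ψ : B →L[ℂ] ℂ, ψ ∈ stateSpace B ∧ ∀ a, ψ (i a) = φ a

variable [StarOrderedRing A] [StarOrderedRing B]

/-- A conditional expectation for `i : A ⊆ B`: a completely positive `A`-bimodule map `B → A` which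
is the identity on `A`. -/
structure IsConditionalExpectation (i : A →⋆ₐ[ℂ] B) (E : B →CP A) : Prop where
  map_incl : ∀ a, E (i a) = a
  map_incl_mul : ∀ a b, E (i a * b) = a * E b
  map_mul_incl : ∀ a b, E (b * i a) = E b * a

/-- `I` is injective in the category of unital C⋆-algebras and unital completely positive maps. -/
def IsInjectiveCStarAlgebra.{u} (I : Type u) [CStarAlgebra I] [PartialOrder I]
    [StarOrderedRing I] : Prop :=
  ∀ (C D : Type u) [CStarAlgebra C] [PartialOrder C] [StarOrderedRing C]
    [CStarAlgebra D] [PartialOrder D] [StarOrderedRing D]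
    (j : C →⋆ₐ[ℂ] D), Function.Injective j →
    ∀ φ : C →CP I, φ 1 = 1 → ∃ ψ : D →CP I, ψ 1 = 1 ∧ ∀ c, ψ (j c) = φ c

/-- `κ : A ⊆ I` is an injective envelope of `A` (in the sense of Hamana): `I` is injective and the
identity is the only completely positive self-map of `I` that fixes `A` pointwise. -/
structure IsInjectiveEnvelope {I : Type*} [CStarAlgebra I] [PartialOrder I] [StarOrderedRing I]
    (κ : A →⋆ₐ[ℂ] I) : Prop where
  injective : Function.Injective κ
  isInjective : IsInjectiveCStarAlgebra I
  rigid : ∀ ψ : I →CP I, (∀ a, ψ (κ a) = κ a) → ∀ x, ψ x = x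

/-- A pseudo-expectation (in the sense of Pitts) for `i : A ⊆ B`, relative to the injective envelope
`κ : A ⊆ I`: a unital completely positive map `B → I` extending the inclusion of `A`. -/
structure IsPseudoExpectation {I : Type*} [CStarAlgebra I] [PartialOrder I] [StarOrderedRing I]
    (i : A →⋆ₐ[ℂ] B) (κ : A →⋆ₐ[ℂ] I) (Φ : B →CP I) : Prop where
  map_one : Φ 1 = 1
  map_incl : ∀ a, Φ (i a) = κ a

/-- Irreducibility of a representation on a Hilbert space: the space is non-zero and there are no
closed invariant subspaces other than `0` and the whole space. -/
def IsIrreducibleRepresentation {A H : Type*} [CStarAlgebra A] [NormedAddCommGroup H]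
    [InnerProductSpace ℂ H] [CompleteSpace H] (π : A →⋆ₐ[ℂ] (H →L[ℂ] H)) : Prop :=
  Nontrivial H ∧ ∀ K : Submodule ℂ H, IsClosed (K : Set H) →
    (∀ a, ∀ x ∈ K, π a x ∈ K) → K = ⊥ ∨ K = ⊤

end Notions

/-- The Hilbert space `L²[-1,1]`. -/
abbrev L2Interval : Type := Lp ℂ 2 (volume.restrict (Set.Icc (-1 : ℝ) 1))

end

/-!
The crossed product `𝒪₂ ⋊ ℤ/2` is `𝒪₂ ⊕ 𝒪₂ u`, where the unitary `u` implements the flip, so a map on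
it that is left `𝒪₂`-linear and prescribed on `𝒪₂` is determined by its value at `u`.

*Conditional expectations.* The coefficient at the identity is one. For any other one `E`, the element
`c = E u` satisfies `c s₀ = s₁ c`, so `c = s₁*ⁿ c s₀ⁿ` for all `n`. On every word `a b*` in the
isometries this compression eventually vanishes, and hence it tends to `0` on all of `𝒪₂`
(`CuntzAlgebra.tendsto_compress`); thus `c = 0`.

*Pseudo-expectations.* A pseudo-expectation `Φ` is `𝒪₂`-bimodular by the multiplicative domain argument,
so `d = Φ u` implements the flip in the injective envelope `I`. The isometry `s₀` has a spectral value on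
the unit circle at which it is not left invertible, so some state of `I` looks like the vector state of an
eigenvector `ξ` of `s₀`. The compression argument above shows that all matrix coefficients of `d` on the
subspace generated by `𝒪₂` and `ξ` in the GNS representation vanish. The compression of `I` to that
subspace is a completely positive map that kills `d` and restricts to a representation of `𝒪₂`, which is
injective because `𝒪₂` is simple (`CuntzAlgebra.injective_of_nontrivial`). Injectivity of `I` gives a
completely positive map back to `I` under which the composition fixes `𝒪₂`; by rigidity the composition
is the identity, and `d = 0` (`CuntzAlgebra.eq_zero_of_forall_inner_eq_zero`).

Simplicity is proved with the gauge action: conjugation by the isometry `λᵏ(s₀ᵏ s₁)`, where `λ` is the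
canonical endomorphism, cuts a ⋆-polynomial down to its gauge-invariant part, and every unital
representation is isometric on the gauge-invariant ⋆-polynomials, as these lie in matrix algebras.

*The representation on `L²[-1,1]`.* The constant function `1` is a common eigenvector of the adjoints
of the two isometries. A subspace that is invariant under these adjoints and orthogonal to `1` is zero,
because the indicator functions of the intervals `[-1,x]` are self-similar under the isometries
(`IntervalRep.eq_zero_of_forall_inner_one_eq_zero`). If `K` is a closed invariant subspace with
projection `P`, this applies to the span of the component of `P 1` orthogonal to `1`, so that `P 1` is a
multiple of `1`; then it applies to `K` or to its orthogonal complement.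

*Pure extensions.* The vector state of the normalized constant function is the only state of `𝒪₂` that
vanishes on `(1 - t)* (1 - t)`, where `t = (s₀ + s₁) / √2`. Hence it is pure. As the vector is fixed by
the reflection `U`, and both `U` and `-U` implement the flip, this state has two extensions to the
crossed product, with the values `1` and `-1` at `u`.
-/

noncomputable section

set_option linter.unusedSectionVars false

/-- This form of `norm_one` covers the zero algebra. -/
theorem norm_one_le_one (A : Type*) [CStarAlgebra A] : ‖(1 : A)‖ ≤ 1 := by
  have h := CStarRing.norm_star_mul_self (x := (1 : A))
  rw [star_one, one_mul] at h
  nlinarith [norm_nonneg (1 : A)]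

/-! ### Words in the Cuntz isometries -/

namespace IsCuntzPair

variable {B : Type*} [Ring B] [StarRing B] {t : Fin 2 → B}

theorem sum_mul_star (ht : IsCuntzPair t) : ∑ i, t i * star (t i) = 1 := by
  rw [Fin.sum_univ_two, ht.sum_range]

theorem star_one_mul_zero (ht : IsCuntzPair t) : star (t 1) * t 0 = 0 := by
  have h := congrArg (fun x => star (t 1) * (x * t 0)) ht.sum_range
  have h0 := ht.isometry 0
  have h1 := ht.isometry 1
  simp only [add_mul, mul_add, mul_assoc, h0, one_mul, mul_one] at h
  simpa [← mul_assoc, h1] using h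

theorem star_mul (ht : IsCuntzPair t) (i j : Fin 2) :
    star (t i) * t j = if i = j then 1 else 0 := by
  split_ifs with h
  · rw [h, ht.isometry]
  · have h10 := ht.star_one_mul_zero
    have h01 : star (t 0) * t 1 = 0 := by simpa using congrArg star h10
    fin_cases i <;> fin_cases j <;> simp_all

end IsCuntzPair

namespace CuntzAlgebra

theorem star_s_mul_s (i j : Fin 2) : star (s i) * s j = if i = j then 1 else 0 :=
  isCuntzPair_s.star_mul i j

theorem star_s_mul_s_mul (i j : Fin 2) (x : CuntzAlgebra) :
    star (s i) * (s j * x) = if i = j then x else 0 := by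
  rw [← mul_assoc, star_s_mul_s]
  split_ifs <;> simp

theorem sum_s_mul_star_s : ∑ i, s i * star (s i) = 1 := isCuntzPair_s.sum_mul_star

/-- `IsWord n a` says that `a` is a product of `n` of the generators `s 0`, `s 1` (no adjoints). -/
inductive IsWord : ℕ → CuntzAlgebra → Prop
  | one : IsWord 0 1
  | s_mul (i : Fin 2) {n : ℕ} {a : CuntzAlgebra} : IsWord n a → IsWord (n + 1) (s i * a)

theorem IsWord.mul_s {n : ℕ} {a : CuntzAlgebra} (ha : IsWord n a) (i : Fin 2) :
    IsWord (n + 1) (a * s i) := by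
  induction ha with
  | one => simpa using IsWord.one.s_mul i
  | s_mul j _ ih => rw [mul_assoc]; exact ih.s_mul j

/-- Every ⋆-monomial in the generators is reached from `1` by left multiplications, so a subspace that
contains `1` and is invariant under left multiplication by the generators and their adjoints is dense. -/
theorem dense_of_forall_mul_mem (M : Submodule ℂ CuntzAlgebra) (h1 : 1 ∈ M)
    (hs : ∀ i, ∀ a ∈ M, s i * a ∈ M) (hs' : ∀ i, ∀ a ∈ M, star (s i) * a ∈ M) :
    Dense (M : Set CuntzAlgebra) := by
  have key : ∀ x : CuntzPoly, ((x : CuntzCompletion) : CuntzAlgebra) ∈ M := by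
    intro x
    induction x using CuntzPoly.induction with
    | h0 => exact (UniformSpace.Completion.coe_zero (α := CuntzPoly) ▸ M.zero_mem)
    | ha x y hx hy =>
      rw [UniformSpace.Completion.coe_add]
      exact M.add_mem hx hy
    | hm w c =>
      have h1 : CuntzPoly.mono w c = c • CuntzPoly.mono w 1 := by
        rw [CuntzPoly.smul_mono, mul_one]
      rw [h1, UniformSpace.Completion.coe_smul]
      refine M.smul_mem c ?_
      clear h1
      induction w using FreeMonoid.inductionOn' with
      | one => rwa [← CuntzPoly.one_def, UniformSpace.Completion.coe_one]
      | of_mul l w hw =>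
        have h2 : CuntzPoly.mono (FreeMonoid.of l * w) 1
            = CuntzPoly.mono (FreeMonoid.of l) 1 * CuntzPoly.mono w 1 := by
          rw [CuntzPoly.mono_mul, one_mul]
        rw [h2, UniformSpace.Completion.coe_mul]
        obtain ⟨i, b⟩ := l
        cases b with
        | false => exact hs i _ hw
        | true =>
          have h3 : CuntzPoly.mono (FreeMonoid.of (i, true)) 1 = star (CuntzPoly.gen i) := by
            rw [CuntzPoly.gen, CuntzPoly.star_mono, star_one]
            rfl
          rw [h3, ← CuntzCompletion.star_coe]
          exact hs' i _ hw
  have hd : DenseRange ((↑) : CuntzPoly → CuntzCompletion) :=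
    UniformSpace.Completion.denseRange_coe
  exact hd.mono (by rintro _ ⟨x, rfl⟩; exact key x)

/-- By the relation `sᵢ* sⱼ = δᵢⱼ`, every ⋆-monomial reduces to `0` or to a product `a b*` of words. -/
theorem dense_of_forall_word_mem (M : Submodule ℂ CuntzAlgebra)
    (h : ∀ m n a b, IsWord m a → IsWord n b → a * star b ∈ M) :
    Dense (M : Set CuntzAlgebra) := by
  let N : Submodule ℂ CuntzAlgebra :=
    Submodule.span ℂ {x | ∃ m n a b, IsWord m a ∧ IsWord n b ∧ x = a * star b}
  have hN : N ≤ M := Submodule.span_le.mpr (by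
    rintro _ ⟨m, n, a, b, ha, hb, rfl⟩
    exact h m n a b ha hb)
  have hmap : ∀ c : CuntzAlgebra, (∀ m n a b, IsWord m a → IsWord n b → c * (a * star b) ∈ N) →
      ∀ x ∈ N, c * x ∈ N := by
    intro c hc x hx
    have : N ≤ N.comap (LinearMap.mulLeft ℂ c) := Submodule.span_le.mpr (by
      rintro _ ⟨m, n, a, b, ha, hb, rfl⟩
      exact hc m n a b ha hb)
    exact this hx
  refine (dense_of_forall_mul_mem N ?_ ?_ ?_).mono hN
  · exact Submodule.subset_span ⟨0, 0, 1, 1, .one, .one, by simp⟩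
  · refine fun i => hmap _ fun m n a b ha hb => ?_
    exact Submodule.subset_span ⟨m + 1, n, s i * a, b, ha.s_mul i, hb, by rw [mul_assoc]⟩
  · refine fun i => hmap _ fun m n a b ha hb => ?_
    cases ha with
    | one => exact Submodule.subset_span ⟨0, n + 1, 1, b * s i, .one, hb.mul_s i,
        by rw [one_mul, one_mul, star_mul]⟩
    | @s_mul j m a ha =>
      rw [mul_assoc (s j), star_s_mul_s_mul]
      split_ifs
      · exact Submodule.subset_span ⟨m, n, a, b, ha, hb, rfl⟩
      · exact N.zero_mem

theorem norm_s_le (i : Fin 2) : ‖s i‖ ≤ 1 := by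
  have h : ‖star (s i) * s i‖ ≤ 1 := by
    rw [star_s_mul_s, if_pos rfl]
    exact norm_one_le_one CuntzAlgebra
  rw [CStarRing.norm_star_mul_self] at h
  nlinarith [norm_nonneg (s i)]

/-- For `i ≠ j`, the compressions `x ↦ sᵢ*ᵏ x sⱼˡ` eventually vanish on `a b*`: they first strip the words
`a` and `b`, and `sᵢ* sⱼ = 0`. -/
theorem compress_word {m n : ℕ} {a b : CuntzAlgebra} (ha : IsWord m a) (hb : IsWord n b) {i j : Fin 2}
    (hij : i ≠ j) : ∃ N, ∀ k ≥ N, ∀ l ≥ N, star (s i) ^ k * (a * star b) * s j ^ l = 0 := by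
  induction ha with
  | one =>
    induction hb with
    | one =>
      refine ⟨1, fun k hk l hl => ?_⟩
      obtain ⟨k, rfl⟩ := Nat.exists_eq_add_of_le' hk
      obtain ⟨l, rfl⟩ := Nat.exists_eq_add_of_le' hl
      rw [pow_succ, pow_succ', star_one, mul_one, mul_one, mul_assoc, ← mul_assoc (star (s i)),
        star_s_mul_s, if_neg hij, zero_mul, mul_zero]
    | @s_mul c n b hb ih =>
      obtain ⟨N, hN⟩ := ih
      refine ⟨N + 1, fun k hk l hl => ?_⟩
      obtain ⟨l, rfl⟩ := Nat.exists_eq_add_of_le' (le_trans (Nat.le_add_left 1 N) hl)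
      have := hN k (by omega) l (by omega)
      rw [one_mul] at this
      rw [one_mul, star_mul, pow_succ', mul_assoc, mul_assoc, star_s_mul_s_mul]
      split_ifs
      · rw [← mul_assoc, this]
      · simp
  | @s_mul c m a ha ih =>
    obtain ⟨N, hN⟩ := ih
    refine ⟨N + 1, fun k hk l hl => ?_⟩
    obtain ⟨k, rfl⟩ := Nat.exists_eq_add_of_le' (le_trans (Nat.le_add_left 1 N) hk)
    have := hN k (by omega) l (by omega)
    rw [pow_succ, mul_assoc (star (s i) ^ k), mul_assoc (s c), star_s_mul_s_mul]
    split_ifs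
    · exact this
    · simp

theorem tendsto_compress (x : CuntzAlgebra) {i j : Fin 2} (hij : i ≠ j) :
    Filter.Tendsto (fun n => star (s i) ^ n * x * s j ^ n) Filter.atTop (nhds 0) := by
  let M : Submodule ℂ CuntzAlgebra :=
    { carrier := {x | ∃ N, ∀ n ≥ N, star (s i) ^ n * x * s j ^ n = 0}
      zero_mem' := ⟨0, by simp⟩
      add_mem' := by
        rintro x y ⟨N, hN⟩ ⟨N', hN'⟩
        refine ⟨max N N', fun n hn => ?_⟩
        rw [mul_add, add_mul, hN n (le_trans (le_max_left _ _) hn),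
          hN' n (le_trans (le_max_right _ _) hn), add_zero]
      smul_mem' := by
        rintro c x ⟨N, hN⟩
        exact ⟨N, fun n hn => by rw [mul_smul_comm, smul_mul_assoc, hN n hn, smul_zero]⟩ }
  have hd : Dense (M : Set CuntzAlgebra) := dense_of_forall_word_mem M fun m n a b ha hb => by
    obtain ⟨N, hN⟩ := compress_word ha hb hij
    exact ⟨N, fun n hn => hN n hn n hn⟩
  rw [Metric.tendsto_atTop]
  intro ε hε
  obtain ⟨y, ⟨N, hN⟩, hy⟩ := hd.exists_dist_lt x hε
  refine ⟨N, fun n hn => ?_⟩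
  have h1 : star (s i) ^ n * x * s j ^ n = star (s i) ^ n * (x - y) * s j ^ n := by
    rw [mul_sub, sub_mul, hN n hn, sub_zero]
  have hp : ∀ k : Fin 2, ‖s k ^ n‖ ≤ 1 := fun k => by
    rcases Nat.eq_zero_or_pos n with rfl | h
    · rw [pow_zero]; exact norm_one_le_one CuntzAlgebra
    · exact (norm_pow_le' _ h).trans (pow_le_one₀ (norm_nonneg _) (norm_s_le k))
  rw [dist_zero_right, h1]
  refine lt_of_le_of_lt ?_ hy
  rw [dist_eq_norm]
  calc ‖star (s i) ^ n * (x - y) * s j ^ n‖ ≤ ‖star (s i) ^ n‖ * ‖x - y‖ * ‖s j ^ n‖ :=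
        (norm_mul_le _ _).trans (mul_le_mul_of_nonneg_right (norm_mul_le _ _) (norm_nonneg _))
    _ ≤ 1 * ‖x - y‖ * 1 := by
        gcongr
        · rw [← star_pow, norm_star]; exact hp i
        · exact hp j
    _ = ‖x - y‖ := by ring

/-- No non-zero element of `𝒪₂` intertwines two different generators; in particular none implements the
flip. -/
theorem eq_zero_of_mul_s_eq {c : CuntzAlgebra} {i j : Fin 2} (hij : i ≠ j)
    (h : c * s j = s i * c) : c = 0 := by
  have h' : ∀ n, star (s i) ^ n * c * s j ^ n = c := by
    intro n
    induction n with
    | zero => simp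
    | succ n ih =>
      rw [pow_succ, pow_succ', mul_assoc, mul_assoc, ← mul_assoc c, h, mul_assoc (s i),
        star_s_mul_s_mul, if_pos rfl, ← mul_assoc, ih]
  have := tendsto_compress c hij
  simp only [h'] at this
  exact tendsto_nhds_unique tendsto_const_nhds this

end CuntzAlgebra

/-! ### States of C⋆-algebras -/

section States

variable {A : Type*} [CStarAlgebra A]

/-- A contractive functional that is `1` at the unit takes real values on self-adjoint elements. -/
theorem im_apply_eq_zero_of_isSelfAdjoint {ψ : A →L[ℂ] ℂ} (h1 : ψ 1 = 1) (hn : ‖ψ‖ ≤ 1) {a : A}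
    (ha : IsSelfAdjoint a) : (ψ a).im = 0 := by
  have key : ∀ t : ℝ, 2 * (ψ a).im * t + (ψ a).im ^ 2 ≤ ‖a‖ ^ 2 := by
    intro t
    set b : A := a + (t * Complex.I : ℂ) • (1 : A) with hb
    have h2 : star b * b = a * a + ((t ^ 2 : ℝ) : ℂ) • (1 : A) := by
      rw [hb, star_add, star_smul, star_one, ha.star_eq]
      simp only [add_mul, mul_add, smul_mul_assoc, mul_smul_comm, one_mul, mul_one,
        star_mul', RCLike.star_def, Complex.conj_I, Complex.conj_ofReal]
      have : (t * -Complex.I * (t * Complex.I) : ℂ) = ((t ^ 2 : ℝ) : ℂ) := by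
        push_cast
        linear_combination (-(t : ℂ) ^ 2) * Complex.I_sq
      rw [← this]
      module
    have h3 : ‖b‖ ^ 2 ≤ ‖a‖ ^ 2 + t ^ 2 := by
      rw [sq, ← CStarRing.norm_star_mul_self, h2]
      refine (norm_add_le _ _).trans (add_le_add ?_ ?_)
      · rw [sq]; exact norm_mul_le _ _
      · rw [norm_smul, Complex.norm_real, Real.norm_of_nonneg (sq_nonneg t)]
        exact mul_le_of_le_one_right (sq_nonneg t) (norm_one_le_one A)
    have h4 : ψ b = ψ a + t * Complex.I := by
      rw [hb, map_add, map_smul, h1, smul_eq_mul, mul_one]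
    have h5 : ‖ψ b‖ ≤ ‖b‖ := (ψ.le_opNorm b).trans (mul_le_of_le_one_left (norm_nonneg b) hn)
    have h6 : (ψ b).im ^ 2 ≤ ‖b‖ ^ 2 := by
      rw [← sq_abs]
      exact pow_le_pow_left₀ (abs_nonneg _) ((Complex.abs_im_le_norm _).trans h5) 2
    rw [h4] at h6
    simp at h6
    nlinarith
  by_contra h
  have := key ((‖a‖ ^ 2 + 1) / (2 * (ψ a).im))
  rw [mul_div_cancel₀ _ (by simpa using h)] at this
  nlinarith [sq_nonneg (ψ a).im]

variable [PartialOrder A] [StarOrderedRing A]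

/-- A contractive functional that is `1` at the unit is positive: `‖‖a‖ - a‖ ≤ ‖a‖` for `a ≥ 0`. -/
theorem mem_stateSpace_of_norm_le_one {ψ : A →L[ℂ] ℂ} (h1 : ψ 1 = 1) (hn : ‖ψ‖ ≤ 1) :
    ψ ∈ stateSpace A := by
  refine ⟨h1, fun a ha => ?_⟩
  have him := im_apply_eq_zero_of_isSelfAdjoint h1 hn ha.isSelfAdjoint
  rw [Complex.nonneg_iff]
  refine ⟨?_, him.symm⟩
  have h2 : 0 ≤ algebraMap ℝ A ‖a‖ - a :=
    sub_nonneg.mpr (IsSelfAdjoint.le_algebraMap_norm_self ha.isSelfAdjoint)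
  have h3 : ‖algebraMap ℝ A ‖a‖ - a‖ ≤ ‖a‖ := by
    rw [CStarAlgebra.norm_le_iff_le_algebraMap _ (norm_nonneg a) h2]
    exact sub_le_self _ ha
  have h4 : ‖ψ (algebraMap ℝ A ‖a‖ - a)‖ ≤ ‖a‖ :=
    ((ψ.le_opNorm _).trans (mul_le_of_le_one_left (norm_nonneg _) hn)).trans h3
  have h5 : ψ (algebraMap ℝ A ‖a‖ - a) = ‖a‖ - ψ a := by
    rw [map_sub, Algebra.algebraMap_eq_smul_one, ← Complex.coe_smul, map_smul, h1, smul_eq_mul,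
      mul_one]
  rw [h5] at h4
  have h6 := (Complex.re_le_norm _).trans h4
  simp at h6
  linarith

/-- By the Hahn–Banach theorem, the left ideal generated by an element without left inverse is
annihilated by some state. -/
theorem exists_mem_stateSpace_of_forall_mul_ne_one {y : A} (hy : ∀ z : A, z * y ≠ 1) :
    ∃ ψ ∈ stateSpace A, ∀ z, ψ (z * y) = 0 := by
  let J : Submodule ℂ A := (LinearMap.range (LinearMap.mulRight ℂ y)).topologicalClosure
  have hJc : IsClosed (J : Set A) := Submodule.isClosed_topologicalClosure _
  have hmem : ∀ z, z * y ∈ J := fun z => Submodule.le_topologicalClosure _ ⟨z, rfl⟩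
  have hdist : ∀ m ∈ J, 1 ≤ ‖1 - m‖ := by
    have hcl : IsClosed {m : A | 1 ≤ ‖1 - m‖} := isClosed_le (by fun_prop) (by fun_prop)
    refine fun m hm => closure_minimal ?_ hcl hm
    rintro _ ⟨z, rfl⟩
    by_contra hlt
    have hlt' : ‖1 - z * y‖ < 1 := not_le.mp hlt
    have hu : IsUnit (z * y) := by
      simpa using (Units.oneSub (1 - z * y) hlt').isUnit
    obtain ⟨u, hu⟩ := hu
    exact hy (↑u⁻¹ * z) (by rw [mul_assoc, ← hu, Units.inv_mul])
  have hinf : 1 ≤ ‖(Submodule.Quotient.mk 1 : A ⧸ J)‖ := by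
    refine le_of_forall_pos_lt_add fun ε hε => ?_
    obtain ⟨m, hm, hm'⟩ := Submodule.Quotient.norm_mk_lt (Submodule.Quotient.mk 1 : A ⧸ J) hε
    refine lt_of_le_of_lt ?_ hm'
    have := hdist (1 - m) ((Submodule.Quotient.eq J).mp hm.symm)
    simpa using this
  have hone : ‖(Submodule.Quotient.mk 1 : A ⧸ J)‖ = 1 :=
    le_antisymm ((Submodule.Quotient.norm_mk_le J 1).trans (norm_one_le_one A)) hinf
  obtain ⟨g, hg, hg1⟩ := exists_dual_vector'' ℂ (Submodule.Quotient.mk 1 : A ⧸ J)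
  have hle : ∀ a, ‖g (Submodule.Quotient.mk a)‖ ≤ 1 * ‖a‖ := fun a =>
    (g.le_opNorm _).trans (mul_le_mul hg (Submodule.Quotient.norm_mk_le J a) (norm_nonneg _) zero_le_one)
  let ψ : A →L[ℂ] ℂ := (g.toLinearMap ∘ₗ J.mkQ).mkContinuous 1 hle
  refine ⟨ψ, mem_stateSpace_of_norm_le_one ?_ (LinearMap.mkContinuous_norm_le _ zero_le_one _),
    fun z => ?_⟩
  · change g (Submodule.Quotient.mk 1) = 1
    rw [hg1, hone]; simp
  · change g (Submodule.Quotient.mk (z * y)) = 0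
    rw [(Submodule.Quotient.mk_eq_zero J).mpr (hmem z), map_zero]

theorem exists_mem_stateSpace_apply_eq_norm [Nontrivial A] {x : A} (hx : 0 ≤ x) :
    ∃ ψ ∈ stateSpace A, ψ x = ‖x‖ := by
  have hsp : ‖x‖ ∈ spectrum ℝ x := CStarAlgebra.norm_mem_spectrum_of_nonneg hx
  have hsa : IsSelfAdjoint (algebraMap ℝ A ‖x‖ - x) :=
    (IsSelfAdjoint.algebraMap A (by rfl)).sub hx.isSelfAdjoint
  obtain ⟨ψ, hψ, h⟩ := exists_mem_stateSpace_of_forall_mul_ne_one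
    (y := algebraMap ℝ A ‖x‖ - x) (fun z hz => hsp (by
      have h2 : (algebraMap ℝ A ‖x‖ - x) * star z = 1 := by
        simpa [hsa.star_eq] using congrArg star hz
      exact isUnit_iff_exists.mpr ⟨z, by rw [left_inv_eq_right_inv hz h2]; exact h2, hz⟩))
  refine ⟨ψ, hψ, ?_⟩
  have := h 1
  rw [one_mul, map_sub, Algebra.algebraMap_eq_smul_one, ← Complex.coe_smul, map_smul, hψ.1,
    smul_eq_mul, mul_one, sub_eq_zero] at this
  exact this.symm

theorem map_star_of_mem_stateSpace {ψ : A →L[ℂ] ℂ} (hψ : ψ ∈ stateSpace A) (x : A) :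
    ψ (star x) = star (ψ x) := by
  let f : A →ₚ[ℂ] ℂ := PositiveLinearMap.mk₀ ψ.toLinearMap hψ.2
  exact map_star f x

/-- By the Cauchy–Schwarz inequality, a state that vanishes on `y* y` vanishes on the left ideal
generated by `y`. -/
theorem apply_mul_eq_zero_of_mem_stateSpace {ψ : A →L[ℂ] ℂ} (hψ : ψ ∈ stateSpace A) {y : A}
    (hy : ψ (star y * y) = 0) (x : A) : ψ (x * y) = 0 := by
  let f : A →ₚ[ℂ] ℂ := PositiveLinearMap.mk₀ ψ.toLinearMap hψ.2
  have h1 := norm_inner_le_norm (𝕜 := ℂ) (f.toPreGNS (star x)) (f.toPreGNS y)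
  have h2 : ‖f.toPreGNS y‖ ^ 2 = (0 : ℂ) := by
    rw [f.preGNS_norm_sq]
    exact hy
  have h3 : ‖f.toPreGNS y‖ = 0 := by simpa using h2
  rw [h3, mul_zero, f.preGNS_inner_def] at h1
  have : f (star (star x) * y) = 0 := norm_le_zero_iff.mp h1
  rwa [star_star] at this

/-- An isometry of a C⋆-algebra has an approximate eigenvalue `z` on the unit circle, and hence a
state which behaves as the vector state of an eigenvector for `z`. -/
theorem exists_mem_stateSpace_of_isometry [Nontrivial A] {v : A} (hv : star v * v = 1) :
    ∃ z : ℂ, star z * z = 1 ∧ ∃ ψ ∈ stateSpace A, ∀ x, ψ (x * v) = z * ψ x := by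
  have hn : ‖v‖ = 1 := by
    have := CStarRing.norm_star_mul_self (x := v)
    rw [hv, CStarRing.norm_one] at this
    nlinarith [norm_nonneg v]
  have hpow : ∀ n : ℕ, ‖v ^ n‖ = 1 := by
    intro n
    have hvn : star (v ^ n) * v ^ n = 1 := by
      induction n with
      | zero => simp
      | succ n ih =>
        rw [star_pow] at ih ⊢
        rw [pow_succ, pow_succ', mul_assoc, ← mul_assoc (star v), hv, one_mul, ih]
    have := CStarRing.norm_star_mul_self (x := v ^ n)
    rw [hvn, CStarRing.norm_one] at this
    nlinarith [norm_nonneg (v ^ n)]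
  have hr : spectralRadius ℂ v = 1 := by
    have := spectrum.pow_norm_pow_one_div_tendsto_nhds_spectralRadius v
    simp only [hpow, Real.one_rpow, ENNReal.ofReal_one] at this
    exact (tendsto_nhds_unique this tendsto_const_nhds)
  obtain ⟨z, hz, hzr⟩ := spectrum.exists_nnnorm_eq_spectralRadius v
  rw [hr] at hzr
  have hz1 : ‖z‖ = 1 := by
    have : ‖z‖₊ = 1 := by exact_mod_cast hzr
    simpa using congrArg NNReal.toReal this
  have hzz : star z * z = 1 := by
    rw [RCLike.star_def, Complex.conj_mul', hz1]; simp
  obtain ⟨ψ, hψ, h⟩ := exists_mem_stateSpace_of_forall_mul_ne_one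
    (y := algebraMap ℂ A z - v) (fun w hw => by
      -- a left invertible limit of the invertible elements `(1 + δ) z - v` is invertible
      obtain ⟨δ, hδ, hδw⟩ : ∃ δ : ℝ, 0 < δ ∧ δ * ‖w‖ < 1 := by
        refine ⟨1 / (‖w‖ + 1), by positivity, ?_⟩
        rw [div_mul_eq_mul_div, one_mul, div_lt_one (by positivity)]
        linarith
      have hμ : IsUnit (algebraMap ℂ A ((1 + δ) * z) - v) := by
        refine spectrum.mem_resolventSet_of_norm_lt (𝕜 := ℂ) ?_
        rw [hn, norm_mul, hz1, mul_one, ← Complex.ofReal_one, ← Complex.ofReal_add,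
          Complex.norm_real, Real.norm_of_nonneg (by positivity)]
        linarith
      have hw2 : w * (algebraMap ℂ A ((1 + δ) * z) - v) = 1 - (-(δ * z) : ℂ) • w := by
        have : algebraMap ℂ A ((1 + δ) * z) - v = (algebraMap ℂ A z - v) + (δ * z : ℂ) • (1 : A) := by
          rw [Algebra.algebraMap_eq_smul_one, Algebra.algebraMap_eq_smul_one]
          module
        rw [this, mul_add, hw, mul_smul_comm, mul_one]
        module
      have hu : IsUnit (w * (algebraMap ℂ A ((1 + δ) * z) - v)) := by
        rw [hw2]
        refine (Units.oneSub _ ?_).isUnit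
        rw [norm_smul, norm_neg, norm_mul, hz1, mul_one, Complex.norm_real,
          Real.norm_of_nonneg hδ.le]
        exact hδw
      obtain ⟨u, hu⟩ := hu
      obtain ⟨m, hm⟩ := hμ
      have hwu : IsUnit w := ⟨u * m⁻¹, by
        rw [Units.val_mul, hu, ← hm, mul_assoc, Units.mul_inv, mul_one]⟩
      obtain ⟨w', rfl⟩ := hwu
      exact hz ⟨w'⁻¹, by rw [← mul_one (↑w'⁻¹ : A), ← hw, ← mul_assoc, Units.inv_mul, one_mul]⟩)
  refine ⟨z, hzz, ψ, hψ, fun x => ?_⟩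
  have := h x
  rw [mul_sub, map_sub, Algebra.algebraMap_eq_smul_one, mul_smul_comm, mul_one, map_smul,
    smul_eq_mul, sub_eq_zero] at this
  exact this.symm

end States

/-! ### Completely positive maps -/

section Positivity

variable {A : Type*} [NonUnitalCStarAlgebra A] [PartialOrder A] [StarOrderedRing A]

theorem exists_eq_star_mul_self_of_nonneg {a : A} (h : 0 ≤ a) : ∃ b, a = star b * b :=
  CStarAlgebra.nonneg_iff_eq_star_mul_self.mp h

theorem exists_eq_sub_of_isSelfAdjoint {a : A} (h : IsSelfAdjoint a) :
    ∃ p q : A, 0 ≤ p ∧ 0 ≤ q ∧ a = p - q ∧ q * p = 0 :=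
  ⟨a⁺, a⁻, CFC.posPart_nonneg a, CFC.negPart_nonneg a, (CFC.posPart_sub_negPart a h).symm,
    CFC.negPart_mul_posPart a⟩

end Positivity

section CompletelyPositive

variable {A B : Type*} [CStarAlgebra A] [PartialOrder A] [StarOrderedRing A]
  [CStarAlgebra B] [PartialOrder B] [StarOrderedRing B]
  {n : Type*} [Fintype n] [DecidableEq n]

theorem CStarMatrix.star_mul_self_apply (N : CStarMatrix n n A) (i j : n) :
    (star N * N) i j = ∑ l, star (N l i) * N l j := by
  rw [CStarMatrix.mul_apply]
  rfl

theorem eq_zero_of_sum_star_mul_self_eq_zero {f : n → A} (h : ∑ l, star (f l) * f l = 0) (l : n) :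
    f l = 0 := by
  have := (Finset.sum_eq_zero_iff_of_nonneg fun l _ => star_mul_self_nonneg (f l)).mp h l
    (Finset.mem_univ l)
  exact CStarRing.star_mul_self_eq_zero_iff _ |>.mp this

/-- A matrix over a C⋆-algebra is positive if its quadratic form is: testing the form on the columns
of the negative part `M⁻` gives `(M⁻)³ ≤ 0` on the diagonal, which forces `M⁻ = 0`. -/
theorem CStarMatrix.nonneg_of_forall_sum_nonneg {M : CStarMatrix n n A} (hM : IsSelfAdjoint M)
    (h : ∀ x : n → A, 0 ≤ ∑ i, ∑ j, star (x i) * M i j * x j) : 0 ≤ M := by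
  obtain ⟨P, N, hP0, hN0, hPN, hNP⟩ := exists_eq_sub_of_isSelfAdjoint hM
  obtain ⟨Q, hQ⟩ := exists_eq_star_mul_self_of_nonneg hN0
  have hNs : star N = N := hN0.isSelfAdjoint.star_eq
  have hNMN : star (Q * N) * (Q * N) = -(N * M * N) := by
    have h1 : N * M = -(N * N) := by rw [hPN, mul_sub, hNP, zero_sub]
    rw [h1, star_mul, hNs, mul_assoc, ← mul_assoc (star Q), ← hQ]
    simp [mul_assoc]
  have hQN : Q * N = 0 := by
    refine CStarMatrix.ext fun l j => ?_
    have h2 : (star (Q * N) * (Q * N)) j j = 0 := by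
      refine le_antisymm ?_ ?_
      · rw [hNMN, CStarMatrix.neg_apply, neg_nonpos]
        have : (N * M * N) j j = ∑ i, ∑ l, star (N i j) * M i l * N l j := by
          rw [Finset.sum_comm, CStarMatrix.mul_apply]
          refine Finset.sum_congr rfl fun l _ => ?_
          rw [CStarMatrix.mul_apply, Finset.sum_mul]
          refine Finset.sum_congr rfl fun i _ => ?_
          rw [← CStarMatrix.star_apply, hNs]
        rw [this]
        exact h fun i => N i j
      · rw [CStarMatrix.star_mul_self_apply]
        exact Finset.sum_nonneg fun l _ => star_mul_self_nonneg _
    rw [CStarMatrix.star_mul_self_apply] at h2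
    exact eq_zero_of_sum_star_mul_self_eq_zero h2 l
  have hN' : N = 0 := by
    have h3 : star N * N = 0 := by
      rw [hNs]
      nth_rewrite 1 [hQ]
      rw [mul_assoc, hQN, mul_zero]
    exact CStarRing.star_mul_self_eq_zero_iff _ |>.mp h3
  rwa [hPN, hN', sub_zero]

/-- A vector on which the quadratic form of a positive matrix vanishes lies in the kernel of the
matrix. -/
theorem CStarMatrix.sum_mul_eq_zero_of_nonneg {M : CStarMatrix n n A} (hM : 0 ≤ M) {v : n → A}
    (hv : ∑ i, ∑ j, star (v i) * M i j * v j = 0) (i : n) : ∑ j, M i j * v j = 0 := by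
  obtain ⟨N, rfl⟩ := exists_eq_star_mul_self_of_nonneg hM
  have h : ∑ l, star (∑ i, N l i * v i) * ∑ i, N l i * v i = 0 := by
    rw [← hv]
    simp only [CStarMatrix.star_mul_self_apply, Finset.mul_sum, Finset.sum_mul, star_sum, star_mul]
    rw [Finset.sum_comm]
    conv_rhs => rw [Finset.sum_comm]
    refine Finset.sum_congr rfl fun j _ => ?_
    rw [Finset.sum_comm]
    refine Finset.sum_congr rfl fun i _ => ?_
    refine Finset.sum_congr rfl fun l _ => ?_
    simp only [mul_assoc]
  have h0 := eq_zero_of_sum_star_mul_self_eq_zero h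
  simp only [CStarMatrix.star_mul_self_apply, Finset.sum_mul]
  rw [Finset.sum_comm]
  refine Finset.sum_eq_zero fun l _ => ?_
  simp only [mul_assoc]
  rw [← Finset.mul_sum, h0, mul_zero]

/-- A unital completely positive map is multiplicative at every `a` at which it preserves `a* a`
(Choi's multiplicative domain). -/
theorem CompletelyPositiveMap.map_mul_of_map_star_mul_self (Φ : A →CP B) (h1 : Φ 1 = 1) {a : A}
    (ha : Φ (star a * a) = star (Φ a) * Φ a) (x : A) : Φ (x * a) = Φ x * Φ a := by
  -- `Φ` is applied to the positive matrix `(yᵢ* yⱼ)`, whose image has the null vector `(-Φ a, 1, 0)`.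
  let y : Fin 3 → A := ![1, a, star x]
  let R : CStarMatrix (Fin 3) (Fin 3) A := CStarMatrix.ofMatrix fun i j => if i = 0 then y j else 0
  have hRa : ∀ i j, R i j = if i = 0 then y j else 0 := fun _ _ => rfl
  have hR : ∀ i j, (star R * R) i j = star (y i) * y j := by
    intro i j
    rw [CStarMatrix.star_mul_self_apply, Fin.sum_univ_three]
    simp [hRa]
  have hpos := Φ.map_cstarMatrix_nonneg (star R * R) (star_mul_self_nonneg R)
  have hst : ∀ z, Φ (star z) = star (Φ z) := fun z => map_star Φ z
  have := CStarMatrix.sum_mul_eq_zero_of_nonneg hpos (v := ![-Φ a, 1, 0]) (by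
    simp [Fin.sum_univ_three, hR, y, h1, ha, hst]) 2
  simp [Fin.sum_univ_three, hR, y] at this
  rw [neg_add_eq_zero] at this
  exact this.symm

/-- The composition of two completely positive maps. -/
def CompletelyPositiveMap.compCP {C : Type*} [CStarAlgebra C] [PartialOrder C] [StarOrderedRing C]
    (Ψ : B →CP C) (Φ : A →CP B) : A →CP C where
  toLinearMap := Ψ.toLinearMap ∘ₗ Φ.toLinearMap
  map_cstarMatrix_nonneg' k M hM :=
    Ψ.map_cstarMatrix_nonneg' k _ (Φ.map_cstarMatrix_nonneg' k M hM)

/-- A unital ⋆-homomorphism as a completely positive map. -/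
def StarAlgHom.toCP (π : A →⋆ₐ[ℂ] B) : A →CP B where
  toLinearMap := π.toAlgHom.toLinearMap
  map_cstarMatrix_nonneg' k M hM :=
    CompletelyPositiveMapClass.map_cstarMatrix_nonneg' π k M hM

theorem StarAlgHom.toCP_apply (π : A →⋆ₐ[ℂ] B) (a : A) : π.toCP a = π a := rfl

/-- A map of the form `x* y ↦ ∑ r, f r x* f r y` is completely positive. -/
def CompletelyPositiveMap.ofSumStarMul {G : Type*} [Fintype G] (φ : A →ₗ[ℂ] B) (f : G → A → B)
    (h : ∀ x y, φ (star x * y) = ∑ r, star (f r x) * f r y) : A →CP B where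
  toLinearMap := φ
  map_cstarMatrix_nonneg' k M hM := by
    obtain ⟨N, rfl⟩ := exists_eq_star_mul_self_of_nonneg hM
    have key : (star N * N).map φ = ∑ r, star (N.map (f r)) * N.map (f r) := by
      refine CStarMatrix.ext fun i j => ?_
      have hs : (∑ r, star (N.map (f r)) * N.map (f r)) i j
          = ∑ r, (star (N.map (f r)) * N.map (f r)) i j :=
        (congrFun (Finset.sum_apply i Finset.univ
          (fun r => (star (N.map (f r)) * N.map (f r) : Fin k → Fin k → B))) j).trans
          (Finset.sum_apply j Finset.univ _)
      rw [hs, CStarMatrix.map_apply, CStarMatrix.star_mul_self_apply, map_sum]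
      simp only [h, CStarMatrix.star_mul_self_apply, CStarMatrix.map_apply]
      rw [Finset.sum_comm]
    rw [key]
    exact Finset.sum_nonneg fun r _ => star_mul_self_nonneg _

section Compression

variable {H K : Type*} [NormedAddCommGroup H] [InnerProductSpace ℂ H] [CompleteSpace H]
  [NormedAddCommGroup K] [InnerProductSpace ℂ K] [CompleteSpace K]

open ContinuousLinearMap in
/-- The compression `x ↦ V* ρ(x) V` of a representation by an operator `V` between Hilbert spaces. -/
def StarAlgHom.compression (ρ : A →⋆ₐ[ℂ] (K →L[ℂ] K)) (V : H →L[ℂ] K) : A →CP (H →L[ℂ] H) where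
  toFun x := adjoint V ∘L ρ x ∘L V
  map_add' x y := by ext; simp
  map_smul' c x := by ext; simp
  map_cstarMatrix_nonneg' k M hM := by
    obtain ⟨N, rfl⟩ := exists_eq_star_mul_self_of_nonneg hM
    have hentry : ∀ i j, adjoint V ∘L ρ ((star N * N) i j) ∘L V
        = ∑ l, adjoint (ρ (N l i) ∘L V) ∘L (ρ (N l j) ∘L V) := by
      intro i j
      rw [CStarMatrix.star_mul_self_apply, map_sum]
      ext x
      have hst : ∀ a : A, ρ (star a) = adjoint (ρ a) := fun a => map_star ρ a
      simp [hst, adjoint_comp, sum_apply]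
    refine CStarMatrix.nonneg_of_forall_sum_nonneg ?_ fun x => ?_
    · refine CStarMatrix.ext fun i j => ?_
      change star (adjoint V ∘L ρ ((star N * N) j i) ∘L V) = adjoint V ∘L ρ ((star N * N) i j) ∘L V
      rw [hentry, hentry, star_sum]
      refine Finset.sum_congr rfl fun l _ => ?_
      rw [star_eq_adjoint, adjoint_comp, adjoint_adjoint]
    · have : ∑ i, ∑ j, star (x i) * (adjoint V ∘L ρ ((star N * N) i j) ∘L V) * x j
          = ∑ l, adjoint (∑ i, (ρ (N l i) ∘L V) ∘L x i) ∘L (∑ i, (ρ (N l i) ∘L V) ∘L x i) := by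
        simp only [hentry, Finset.mul_sum, Finset.sum_mul, map_sum]
        have hr : ∀ l, (∑ i, adjoint ((ρ (N l i) ∘L V) ∘L x i)) ∘L (∑ j, (ρ (N l j) ∘L V) ∘L x j)
            = ∑ i, ∑ j, adjoint ((ρ (N l i) ∘L V) ∘L x i) ∘L ((ρ (N l j) ∘L V) ∘L x j) := by
          intro l
          ext z
          simp [sum_apply]
          rw [Finset.sum_comm]
        simp only [hr]
        rw [Finset.sum_comm' (t' := Finset.univ) (s' := fun _ => Finset.univ) (by simp)]
        conv_rhs => rw [Finset.sum_comm]
        rw [Finset.sum_comm]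
        refine Finset.sum_congr rfl fun i _ => ?_
        conv_rhs => rw [Finset.sum_comm]
        refine Finset.sum_congr rfl fun j _ => Finset.sum_congr rfl fun l _ => ?_
        ext z
        simp [star_eq_adjoint, adjoint_comp]
      change 0 ≤ ∑ i, ∑ j, star (x i) * (adjoint V ∘L ρ ((star N * N) i j) ∘L V) * x j
      rw [this]
      refine Finset.sum_nonneg fun l _ => ?_
      rw [nonneg_iff_isPositive]
      exact isPositive_adjoint_comp_self _

theorem StarAlgHom.compression_apply (ρ : A →⋆ₐ[ℂ] (K →L[ℂ] K)) (V : H →L[ℂ] K) (x : A) :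
    ρ.compression V x = ContinuousLinearMap.adjoint V ∘L ρ x ∘L V := rfl

end Compression

end CompletelyPositive

/-! ### The canonical conditional expectation of a crossed product -/

namespace CrossedProduct

variable {A : Type*} [CStarAlgebra A] [PartialOrder A] [StarOrderedRing A]
  {G : Type*} [Group G] [Fintype G] [DecidableEq G] (α : G →* (A ≃⋆ₐ[ℂ] A))

/-- The coefficient of `x ∈ A ⋊ G` at the identity, as a linear map. -/
def coeffOne : CrossedProduct α →ₗ[ℂ] A where
  toFun x := x.1 1 1
  map_add' _ _ := rfl
  map_smul' _ _ := rfl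

/-- The canonical conditional expectation `A ⋊ G → A`: the coefficient at the identity. -/
def expectation : CrossedProduct α →CP A :=
  CompletelyPositiveMap.ofSumStarMul (coeffOne α) (fun r x => α r⁻¹ (x.1 1 r⁻¹)) fun x y => by
    change (star x * y).1 1 1 = _
    rw [mul_val_apply]
    refine Finset.sum_congr rfl fun r _ => ?_
    rw [star_val_apply, one_mul]

theorem expectation_apply (x : CrossedProduct α) : expectation α x = x.1 1 1 := rfl

theorem isConditionalExpectation_expectation :
    IsConditionalExpectation (incl α) (expectation α) where
  map_incl a := by rw [expectation_apply, incl_val_apply, if_pos rfl]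
  map_incl_mul a b := by
    rw [expectation_apply, expectation_apply, mul_val_apply, Finset.sum_eq_single 1]
    · simp [incl_val_apply]
    · intro r _ hr
      rw [incl_val_apply, if_neg (Ne.symm hr), zero_mul]
    · simp
  map_mul_incl a b := by
    rw [expectation_apply, expectation_apply, mul_val_apply, Finset.sum_eq_single 1]
    · simp [incl_val_apply]
    · intro r _ hr
      rw [incl_val_apply, if_neg (by simpa using hr), map_zero, mul_zero]
    · simp

end CrossedProduct

namespace CuntzAlgebra

open CrossedProduct

/-- The generator of the acting group `ℤ/2`. -/
abbrev flipGen : Multiplicative (ZMod 2) := Multiplicative.ofAdd 1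

theorem flipAction_flipGen : flipAction flipGen = flip := by
  have h : flipGen ≠ 1 := by decide
  change (if flipGen = 1 then 1 else flip) = flip
  rw [if_neg h]

/-- The decomposition `𝒪₂ ⋊ ℤ/2 = 𝒪₂ ⊕ 𝒪₂ u`. -/
theorem eq_incl_add_incl_mul (x : CrossedProduct flipAction) :
    x = incl flipAction (expectation flipAction x)
      + incl flipAction (x.1 1 flipGen) * translation flipAction flipGen := by
  have huniv : (Finset.univ : Finset (Multiplicative (ZMod 2))) = {1, flipGen} := by decide
  conv_lhs => rw [eq_sum flipAction x]
  rw [huniv, Finset.sum_pair (by decide), translation_one, mul_one, inv_one]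
  rfl

theorem translation_mul_incl_s (i : Fin 2) :
    translation flipAction flipGen * incl flipAction (s i)
      = incl flipAction (s (Equiv.swap 0 1 i)) * translation flipAction flipGen := by
  rw [translation_mul_incl, flipAction_flipGen, flip_s]

theorem existsUnique_isConditionalExpectation :
    ∃! E : CrossedProduct flipAction →CP CuntzAlgebra,
      IsConditionalExpectation (incl flipAction) E := by
  refine ⟨expectation flipAction, isConditionalExpectation_expectation flipAction, fun E hE => ?_⟩
  have hu : E (translation flipAction flipGen) = 0 := by
    refine eq_zero_of_mul_s_eq (i := 1) (j := 0) (by decide) ?_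
    rw [← hE.map_mul_incl, translation_mul_incl_s, hE.map_incl_mul]
    simp
  refine DFunLike.ext _ _ fun x => ?_
  conv_lhs => rw [eq_incl_add_incl_mul x]
  rw [map_add, hE.map_incl, hE.map_incl_mul, hu, mul_zero, add_zero]

end CuntzAlgebra

/-! ### Simplicity of the Cuntz algebra -/

namespace CuntzAlgebra

/-- The canonical endomorphism `x ↦ s₀ x s₀* + s₁ x s₁*` of `𝒪₂`. -/
def shift (x : CuntzAlgebra) : CuntzAlgebra := ∑ i, s i * x * star (s i)

theorem shift_one : shift 1 = 1 := by
  simp only [shift, mul_one, sum_s_mul_star_s]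

theorem shift_zero : shift 0 = 0 := by simp [shift]

theorem star_shift (x : CuntzAlgebra) : star (shift x) = shift (star x) := by
  simp [shift, mul_assoc]

theorem shift_mul_s (x : CuntzAlgebra) (j : Fin 2) : shift x * s j = s j * x := by
  simp only [shift, Finset.sum_mul, mul_assoc, star_s_mul_s]
  simp

theorem star_s_mul_shift (x : CuntzAlgebra) (j : Fin 2) : star (s j) * shift x = x * star (s j) := by
  simp only [shift, Finset.mul_sum, mul_assoc, star_s_mul_s_mul]
  simp

theorem shift_mul (x y : CuntzAlgebra) : shift (x * y) = shift x * shift y := by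
  conv_rhs => rw [shift, Finset.sum_mul]
  rw [shift]
  refine Finset.sum_congr rfl fun i _ => ?_
  rw [mul_assoc (s i * x), star_s_mul_shift]
  simp only [mul_assoc]

theorem iterate_shift_mul (k : ℕ) (x y : CuntzAlgebra) :
    shift^[k] (x * y) = shift^[k] x * shift^[k] y :=
  (Function.Semiconj₂.iterate (f := shift) (op := (· * ·)) shift_mul k) x y

theorem star_iterate_shift (k : ℕ) (x : CuntzAlgebra) :
    star (shift^[k] x) = shift^[k] (star x) :=
  ((Function.Commute.iterate_right (f := star) (g := shift) star_shift k) x)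

theorem iterate_shift_one (k : ℕ) : shift^[k] 1 = 1 := Function.iterate_fixed shift_one k

theorem iterate_shift_zero (k : ℕ) : shift^[k] 0 = 0 := Function.iterate_fixed shift_zero k

theorem iterate_shift_mul_word {m : ℕ} {a : CuntzAlgebra} (ha : IsWord m a) (k : ℕ)
    (x : CuntzAlgebra) : shift^[k + m] x * a = a * shift^[k] x := by
  induction ha with
  | one => simp
  | @s_mul i m a _ ih =>
    rw [← add_assoc, Function.iterate_succ_apply', ← mul_assoc, shift_mul_s, mul_assoc, ih, mul_assoc]

theorem star_pow_mul_iterate_shift (k : ℕ) (x : CuntzAlgebra) :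
    star (s 0) ^ k * shift^[k] x = x * star (s 0) ^ k := by
  induction k generalizing x with
  | zero => simp
  | succ k ih =>
    rw [Function.iterate_succ_apply, pow_succ', mul_assoc, ih, ← mul_assoc, star_s_mul_shift,
      mul_assoc]

theorem star_pow_mul_pow (k l : ℕ) : star (s 0) ^ k * s 0 ^ (k + l) = s 0 ^ l := by
  induction k with
  | zero => simp
  | succ k ih =>
    rw [pow_succ, add_right_comm, pow_succ' (s 0), mul_assoc, star_s_mul_s_mul, if_pos rfl, ih]

/-- The word `ω = s₀ᵏ s₁` does not overlap with itself under shifts by at most `k` letters. -/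
theorem star_mul_iterate_shift_eq_zero {k j : ℕ} (hj : 1 ≤ j) (hjk : j ≤ k) :
    star (s 0 ^ k * s 1) * shift^[j] (s 0 ^ k * s 1) = 0 := by
  obtain ⟨l, rfl⟩ := Nat.exists_eq_add_of_le hjk
  obtain ⟨j, rfl⟩ := Nat.exists_eq_add_of_le' hj
  have h1 : star (s 0 ^ (j + 1 + l)) = star (s 0) ^ l * star (s 0) ^ (j + 1) := by
    rw [star_pow, ← pow_add, add_comm]
  rw [star_mul, h1, mul_assoc, mul_assoc, star_pow_mul_iterate_shift,
    show j + 1 + l = l + (j + 1) by ring, ← mul_assoc (star (s 0) ^ l),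
    ← mul_assoc (star (s 0) ^ l), star_pow_mul_pow, pow_succ', mul_assoc, mul_assoc,
    star_s_mul_s_mul, if_neg (by decide)]

/-- The isometry `λᵏ(s₀ᵏ s₁)`, where `λ` is the canonical endomorphism; compression by it computes the
gauge-invariant part of a ⋆-polynomial of degree at most `k`. -/
def cutter (k : ℕ) : CuntzAlgebra := shift^[k] (s 0 ^ k * s 1)

theorem star_omega_mul_omega (k : ℕ) : star (s 0 ^ k * s 1) * (s 0 ^ k * s 1) = 1 := by
  have := star_pow_mul_pow k 0
  rw [add_zero, pow_zero] at this
  rw [star_mul, star_pow, mul_assoc, ← mul_assoc (star (s 0) ^ k), this, one_mul, star_s_mul_s,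
    if_pos rfl]

theorem star_cutter_mul_cutter (k : ℕ) : star (cutter k) * cutter k = 1 := by
  rw [cutter, star_iterate_shift, ← iterate_shift_mul, star_omega_mul_omega, iterate_shift_one]

theorem cutter_compress {m n k : ℕ} {a b : CuntzAlgebra} (ha : IsWord m a) (hb : IsWord n b)
    (hm : m ≤ k) (hn : n ≤ k) :
    star (cutter k) * (a * star b) * cutter k = if m = n then a * star b else 0 := by
  set w := s 0 ^ k * s 1 with hw
  have h1 : star (cutter k) * a = a * shift^[k - m] (star w) := by
    have := iterate_shift_mul_word ha (k - m) (star w)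
    rwa [Nat.sub_add_cancel hm, ← star_iterate_shift] at this
  have h2 : ∀ w, star b * shift^[k] w = shift^[k - n] w * star b := by
    intro w
    have := congrArg star (iterate_shift_mul_word hb (k - n) (star w))
    rwa [Nat.sub_add_cancel hn, star_mul, star_mul, star_iterate_shift, star_iterate_shift,
      star_star] at this
  have h3 : star (cutter k) * (a * star b) * cutter k
      = a * (shift^[k - m] (star w) * shift^[k - n] w) * star b := by
    rw [← mul_assoc, h1, mul_assoc, cutter, ← hw, h2]
    simp only [mul_assoc]
  rw [h3]
  rcases lt_trichotomy m n with h | h | h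
  · have h4 : k - m = (k - n) + (n - m) := by omega
    have h5 : shift^[n - m] (star w) * w = 0 := by
      have := congrArg star (star_mul_iterate_shift_eq_zero (k := k) (j := n - m) (by omega) (by omega))
      rwa [star_mul, star_star, star_zero, star_iterate_shift] at this
    rw [if_neg h.ne, h4, Function.iterate_add_apply, ← iterate_shift_mul, h5, iterate_shift_zero]
    simp
  · subst h
    rw [if_pos rfl, ← iterate_shift_mul, star_omega_mul_omega, iterate_shift_one, mul_one]
  · have h4 : k - n = (k - m) + (m - n) := by omega
    rw [if_neg h.ne', h4, Function.iterate_add_apply, ← iterate_shift_mul,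
      star_mul_iterate_shift_eq_zero (by omega) (by omega), iterate_shift_zero]
    simp

/-- The finite-dimensional subalgebras `core k ≅ M_{2^k}(ℂ)` spanned by the `a b*` with `a`, `b` words of
length `k`, described recursively by `x ∈ core (k + 1) ↔ ∀ i j, sᵢ* x sⱼ ∈ core k`. -/
def core : ℕ → StarSubalgebra ℂ CuntzAlgebra
  | 0 => ⊥
  | k + 1 =>
    { carrier := {x | ∀ i j, star (s i) * x * s j ∈ core k}
      mul_mem' := by
        intro x y hx hy i j
        have : star (s i) * (x * y) * s j
            = ∑ l, (star (s i) * x * s l) * (star (s l) * y * s j) := by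
          calc star (s i) * (x * y) * s j
              = star (s i) * x * (∑ l, s l * star (s l)) * (y * s j) := by
                rw [sum_s_mul_star_s, mul_one]; simp only [mul_assoc]
            _ = _ := by
                rw [Finset.mul_sum, Finset.sum_mul]
                simp only [mul_assoc]
        rw [this]
        exact sum_mem fun l _ => mul_mem (hx i l) (hy l j)
      add_mem' := by
        intro x y hx hy i j
        rw [mul_add, add_mul]
        exact add_mem (hx i j) (hy i j)
      algebraMap_mem' := by
        intro c i j
        rw [Algebra.algebraMap_eq_smul_one, mul_smul_comm, mul_one, smul_mul_assoc, star_s_mul_s]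
        split_ifs
        · exact SMulMemClass.smul_mem c (one_mem _)
        · rw [smul_zero]; exact zero_mem _
      star_mem' := by
        intro x hx i j
        have := star_mem (hx j i)
        rwa [star_mul, star_mul, star_star, ← mul_assoc] at this }

theorem mem_core_succ {k : ℕ} {x : CuntzAlgebra} :
    x ∈ core (k + 1) ↔ ∀ i j, star (s i) * x * s j ∈ core k := Iff.rfl

theorem isClosed_core (k : ℕ) : IsClosed (core k : Set CuntzAlgebra) := by
  induction k with
  | zero =>
    have h : (core 0 : Set CuntzAlgebra) = (Submodule.span ℂ {(1 : CuntzAlgebra)} : Set CuntzAlgebra) := by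
      ext x
      change x ∈ (⊥ : StarSubalgebra ℂ CuntzAlgebra) ↔ _
      rw [StarSubalgebra.mem_bot, SetLike.mem_coe, Submodule.mem_span_singleton]
      simp [Algebra.algebraMap_eq_smul_one]
    rw [h]
    exact Submodule.closed_of_finiteDimensional _
  | succ k ih =>
    have : (core (k + 1) : Set CuntzAlgebra)
        = ⋂ i, ⋂ j, (fun x => star (s i) * x * s j) ⁻¹' (core k : Set CuntzAlgebra) := by
      ext x
      simp only [Set.mem_iInter, Set.mem_preimage, SetLike.mem_coe, mem_core_succ]
    rw [this]
    exact isClosed_iInter fun i => isClosed_iInter fun j => ih.preimage (by fun_prop)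

theorem core_le_succ (k : ℕ) : core k ≤ core (k + 1) := by
  induction k with
  | zero =>
    intro x hx
    change x ∈ (⊥ : StarSubalgebra ℂ CuntzAlgebra) at hx
    obtain ⟨c, rfl⟩ := StarSubalgebra.mem_bot.mp hx
    exact algebraMap_mem _ c
  | succ k ih => exact fun x hx i j => ih (hx i j)

theorem core_mono : Monotone core := monotone_nat_of_le_succ core_le_succ

theorem word_mul_star_word_mem_core {m : ℕ} {a b : CuntzAlgebra} (ha : IsWord m a) (hb : IsWord m b) :
    a * star b ∈ core m := by
  induction ha generalizing b with
  | one =>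
    cases hb
    simp
  | @s_mul i m a ha ih =>
    cases hb with
    | @s_mul j _ b hb =>
      intro k l
      have h : star (s k) * (s i * a * star (s j * b)) * s l
          = (star (s k) * (s i * a)) * star (star (s l) * (s j * b)) := by
        rw [star_mul (star (s l)), star_star]
        simp only [mul_assoc]
      rw [h, star_s_mul_s_mul, star_s_mul_s_mul]
      split_ifs
      · exact ih hb
      · simp
      · simp
      · simp

section Representation

variable {B : Type*} [CStarAlgebra B] [Nontrivial B] (π : CuntzAlgebra →⋆ₐ[ℂ] B)

include π in
theorem eq_zero_of_mem_core {k : ℕ} {x : CuntzAlgebra} (hx : x ∈ core k) (h : π x = 0) : x = 0 := by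
  induction k generalizing x with
  | zero =>
    change x ∈ (⊥ : StarSubalgebra ℂ CuntzAlgebra) at hx
    obtain ⟨c, rfl⟩ := StarSubalgebra.mem_bot.mp hx
    rw [AlgHomClass.commutes, map_eq_zero_iff _ (algebraMap ℂ B).injective] at h
    rw [h, map_zero]
  | succ k ih =>
    have h0 : ∀ i j, star (s i) * x * s j = 0 := fun i j => ih (hx i j) (by
      rw [map_mul, map_mul, h, mul_zero, zero_mul])
    calc x = (∑ i, s i * star (s i)) * x * ∑ j, s j * star (s j) := by
          rw [sum_s_mul_star_s, one_mul, mul_one]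
      _ = ∑ i, ∑ j, s i * (star (s i) * x * s j) * star (s j) := by
          simp only [Finset.sum_mul, Finset.mul_sum, mul_assoc]
          rw [Finset.sum_comm]
      _ = 0 := by simp [h0]

theorem norm_map_of_mem_core {k : ℕ} {x : CuntzAlgebra} (hx : x ∈ core k) : ‖π x‖ = ‖x‖ := by
  have : IsClosed (core k : Set CuntzAlgebra) := isClosed_core k
  have hinj : Function.Injective (π.comp (core k).subtype) := by
    rw [injective_iff_map_eq_zero]
    intro y hy
    exact Subtype.ext (eq_zero_of_mem_core π y.2 hy)
  exact NonUnitalStarAlgHom.norm_map (π.comp (core k).subtype) hinj ⟨x, hx⟩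

end Representation

/-! ### The gauge action -/

theorem star_coe_mul_coe (z : Circle) : star (z : ℂ) * z = 1 := by
  rw [RCLike.star_def, Complex.conj_mul', Circle.norm_coe]
  simp

/-- The gauge automorphisms `s i ↦ z s i` of `𝒪₂`, for `z` on the unit circle. -/
def gauge (z : Circle) : CuntzAlgebra →⋆ₐ[ℂ] CuntzAlgebra :=
  lift (fun i => (z : ℂ) • s i)
    { isometry := fun i => by
        rw [star_smul, smul_mul_smul_comm, star_s_mul_s, if_pos rfl, star_coe_mul_coe, one_smul]
      sum_range := by
        simp only [star_smul, smul_mul_smul_comm]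
        rw [mul_comm (z : ℂ), star_coe_mul_coe, one_smul, one_smul, isCuntzPair_s.sum_range] }

theorem gauge_s (z : Circle) (i : Fin 2) : gauge z (s i) = (z : ℂ) • s i := lift_s _ _ i

theorem gauge_one_apply (x : CuntzAlgebra) : gauge 1 x = x := by
  have : gauge 1 = StarAlgHom.id ℂ CuntzAlgebra := hom_ext fun i => by
    rw [gauge_s]; simp
  rw [this]; rfl

theorem gauge_word (z : Circle) {m : ℕ} {a : CuntzAlgebra} (ha : IsWord m a) :
    gauge z a = (z : ℂ) ^ m • a := by
  induction ha with
  | one => simp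
  | s_mul i _ ih => rw [map_mul, gauge_s, ih, smul_mul_smul_comm, pow_succ']

theorem gauge_word_mul_star_word (z : Circle) {m n : ℕ} {a b : CuntzAlgebra} (ha : IsWord m a)
    (hb : IsWord n b) : gauge z (a * star b) = ((z : ℂ) ^ m * star (z : ℂ) ^ n) • (a * star b) := by
  rw [map_mul, map_star, gauge_word z ha, gauge_word z hb, star_smul, smul_mul_smul_comm, star_pow]

theorem norm_gauge_le (z : Circle) (x : CuntzAlgebra) : ‖gauge z x‖ ≤ ‖x‖ :=
  NonUnitalStarAlgHom.norm_apply_le (gauge z) x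

theorem continuous_gauge (x : CuntzAlgebra) : Continuous fun z => gauge z x := by
  let M : Submodule ℂ CuntzAlgebra :=
    { carrier := {x | Continuous fun z => gauge z x}
      zero_mem' := by simpa using continuous_const
      add_mem' := fun {x y} hx hy => by
        change Continuous fun z => gauge z (x + y)
        simp only [map_add]
        exact Continuous.add hx hy
      smul_mem' := fun c x hx => by
        change Continuous fun z => gauge z (c • x)
        simp only [map_smul]
        exact Continuous.const_smul hx c }
  have hd : Dense (M : Set CuntzAlgebra) := dense_of_forall_word_mem M fun m n a b ha hb => by
    change Continuous fun z => gauge z (a * star b)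
    simp only [gauge_word_mul_star_word _ ha hb]
    have : Continuous fun z : Circle => (z : ℂ) := continuous_subtype_val
    fun_prop
  refine continuous_of_uniform_approx_of_continuous fun u hu => ?_
  obtain ⟨ε, hε, hu⟩ := Metric.mem_uniformity_dist.mp hu
  obtain ⟨y, hy, hxy⟩ := hd.exists_dist_lt x hε
  refine ⟨fun z => gauge z y, hy, fun z => hu ?_⟩
  rw [dist_eq_norm, ← map_sub]
  rw [dist_eq_norm] at hxy
  exact (norm_gauge_le z _).trans_lt hxy

theorem integral_gauge_word (f : CuntzAlgebra →L[ℂ] ℂ) {m n : ℕ} {a b : CuntzAlgebra}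
    (ha : IsWord m a) (hb : IsWord n b) :
    ∫ θ in (0 : ℝ)..2 * Real.pi, f (gauge (Circle.exp θ) (a * star b))
      = if m = n then 2 * Real.pi * f (a * star b) else 0 := by
  have h : ∀ θ : ℝ, f (gauge (Circle.exp θ) (a * star b))
      = Complex.exp (((m : ℂ) - n) * Complex.I * θ) * f (a * star b) := by
    intro θ
    rw [gauge_word_mul_star_word _ ha hb, map_smul, smul_eq_mul, Circle.coe_exp, RCLike.star_def,
      ← Complex.exp_conj, ← Complex.exp_nat_mul, ← Complex.exp_nat_mul, ← Complex.exp_add]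
    congr 2
    simp
    ring
  simp only [h]
  rw [intervalIntegral.integral_mul_const]
  split_ifs with hmn
  · subst hmn
    simp
  · have hc : ((m : ℂ) - n) * Complex.I ≠ 0 :=
      mul_ne_zero (sub_ne_zero.mpr (by exact_mod_cast hmn)) Complex.I_ne_zero
    rw [integral_exp_mul_complex hc]
    have : Complex.exp (((m : ℂ) - n) * Complex.I * ((2 * Real.pi : ℝ) : ℂ)) = 1 := by
      rw [Complex.exp_eq_one_iff]
      exact ⟨(m : ℤ) - n, by push_cast; ring⟩
    rw [this]
    simp

open intervalIntegral in
/-- ⋆-polynomials `x` have a gauge-invariant part `y`, which lies in some `core k`, is obtained from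
`x` by compression, and is the mean of the gauge orbit of `x`. -/
theorem dense_hasGaugeInvariantPart :
    Dense {x : CuntzAlgebra | ∃ y, ∃ k, y ∈ core k ∧ star (cutter k) * x * cutter k = y ∧
      ∀ f : CuntzAlgebra →L[ℂ] ℂ,
        ∫ θ in (0 : ℝ)..2 * Real.pi, f (gauge (Circle.exp θ) x) = 2 * Real.pi * f y} := by
  have hcont : ∀ (f : CuntzAlgebra →L[ℂ] ℂ) x, Continuous fun θ : ℝ => f (gauge (Circle.exp θ) x) :=
    fun f x => f.continuous.comp ((continuous_gauge x).comp Circle.exp.continuous)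
  let M : Submodule ℂ CuntzAlgebra :=
    { carrier := {x | ∃ y, ∃ N, ∀ k ≥ N, y ∈ core k ∧ star (cutter k) * x * cutter k = y ∧
        ∀ f : CuntzAlgebra →L[ℂ] ℂ,
          ∫ θ in (0 : ℝ)..2 * Real.pi, f (gauge (Circle.exp θ) x) = 2 * Real.pi * f y}
      zero_mem' := ⟨0, 0, fun k _ => ⟨zero_mem _, by simp, by simp⟩⟩
      add_mem' := by
        rintro x x' ⟨y, N, h⟩ ⟨y', N', h'⟩
        refine ⟨y + y', max N N', fun k hk => ?_⟩
        obtain ⟨h1, h2, h3⟩ := h k (le_trans (le_max_left _ _) hk)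
        obtain ⟨h1', h2', h3'⟩ := h' k (le_trans (le_max_right _ _) hk)
        refine ⟨add_mem h1 h1', by rw [mul_add, add_mul, h2, h2'], fun f => ?_⟩
        simp only [map_add]
        rw [integral_add ((hcont f x).intervalIntegrable _ _) ((hcont f x').intervalIntegrable _ _),
          h3, h3', mul_add]
      smul_mem' := by
        rintro c x ⟨y, N, h⟩
        refine ⟨c • y, N, fun k hk => ?_⟩
        obtain ⟨h1, h2, h3⟩ := h k hk
        refine ⟨SMulMemClass.smul_mem c h1, by rw [mul_smul_comm, smul_mul_assoc, h2], fun f => ?_⟩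
        simp only [map_smul, smul_eq_mul]
        rw [intervalIntegral.integral_const_mul, h3]
        ring }
  refine (dense_of_forall_word_mem M fun m n a b ha hb => ?_).mono
    (by rintro x ⟨y, N, h⟩; exact ⟨y, N, h N le_rfl⟩)
  refine ⟨if m = n then a * star b else 0, max m n, fun k hk => ?_⟩
  refine ⟨?_, cutter_compress ha hb (le_trans (le_max_left _ _) hk) (le_trans (le_max_right _ _) hk),
    fun f => ?_⟩
  · split_ifs with hmn
    · subst hmn
      exact core_mono (le_trans (le_max_left _ _) hk) (word_mul_star_word_mem_core ha hb)
    · exact zero_mem _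
  · rw [integral_gauge_word f ha hb]
    split_ifs <;> simp

theorem norm_cutter_le (k : ℕ) : ‖cutter k‖ ≤ 1 := by
  have h := CStarRing.norm_star_mul_self (x := cutter k)
  rw [star_cutter_mul_cutter] at h
  nlinarith [norm_nonneg (cutter k), norm_one_le_one CuntzAlgebra]

open intervalIntegral in
/-- Simplicity of `𝒪₂`: every unital representation is injective. If `π` killed `x ≥ 0`, then the
gauge-invariant part of `x` would be small, since `π` is isometric on gauge-invariant
⋆-polynomials; but its value at a state which detects `x` is the mean of a continuous
non-negative function which does not vanish at the identity. -/
theorem injective_of_nontrivial {B : Type*} [CStarAlgebra B] [Nontrivial B]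
    (π : CuntzAlgebra →⋆ₐ[ℂ] B) : Function.Injective π := by
  rw [injective_iff_map_eq_zero]
  intro x₀ hx₀
  by_contra hne
  have : Nontrivial CuntzAlgebra := ⟨x₀, 0, hne⟩
  set x := star x₀ * x₀ with hx
  have hx0 : 0 ≤ x := star_mul_self_nonneg x₀
  have hπ : π x = 0 := by rw [hx, map_mul, hx₀, mul_zero]
  have hxn : 0 < ‖x‖ := norm_pos_iff.mpr fun h => hne (CStarRing.star_mul_self_eq_zero_iff _ |>.mp h)
  obtain ⟨f, hf, hfx⟩ := exists_mem_stateSpace_apply_eq_norm hx0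
  have hcont : ∀ y, Continuous fun θ : ℝ => f (gauge (Circle.exp θ) y) :=
    fun y => f.continuous.comp ((continuous_gauge y).comp Circle.exp.continuous)
  have hpos : 0 < ∫ θ in (0 : ℝ)..2 * Real.pi, (f (gauge (Circle.exp θ) x)).re := by
    refine integral_pos (by positivity) (Complex.continuous_re.comp (hcont x)).continuousOn ?_
      ⟨0, ⟨le_rfl, by positivity⟩, ?_⟩
    · intro θ _
      have : 0 ≤ gauge (Circle.exp θ) x := by
        rw [hx, map_mul, map_star]
        exact star_mul_self_nonneg _
      exact (Complex.nonneg_iff.mp (hf.2 _ this)).1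
    · rw [Circle.exp_zero, gauge_one_apply, hfx]
      simpa using hxn
  set δ := ‖∫ θ in (0 : ℝ)..2 * Real.pi, f (gauge (Circle.exp θ) x)‖ with hδ
  have hδ0 : 0 < δ := by
    have h1 : (∫ θ in (0 : ℝ)..2 * Real.pi, f (gauge (Circle.exp θ) x)).re
        = ∫ θ in (0 : ℝ)..2 * Real.pi, (f (gauge (Circle.exp θ) x)).re :=
      (Complex.reCLM.intervalIntegral_comp_comm ((hcont x).intervalIntegrable _ _)).symm
    exact lt_of_lt_of_le (h1 ▸ hpos) (Complex.re_le_norm _)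
  have hf1 : ∀ y, ‖f y‖ ≤ ‖f‖ * ‖y‖ := f.le_opNorm
  set C := 2 * Real.pi * ‖f‖ with hC
  have hC0 : 0 ≤ C := by positivity
  obtain ⟨x', ⟨y, k, hyk, hxy, hint⟩, hd⟩ :=
    dense_hasGaugeInvariantPart.exists_dist_lt x (show 0 < δ / (2 * (C + 1)) by positivity)
  rw [dist_eq_norm] at hd
  have hy : ‖y‖ ≤ ‖x - x'‖ := by
    rw [← norm_map_of_mem_core π hyk, ← hxy]
    have : π (star (cutter k) * x' * cutter k) = π (star (cutter k) * (x' - x) * cutter k) := by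
      simp [hπ]
    rw [this]
    calc _ ≤ ‖star (cutter k) * (x' - x) * cutter k‖ := NonUnitalStarAlgHom.norm_apply_le π _
      _ ≤ ‖star (cutter k)‖ * ‖x' - x‖ * ‖cutter k‖ :=
        (norm_mul_le _ _).trans (mul_le_mul_of_nonneg_right (norm_mul_le _ _) (norm_nonneg _))
      _ ≤ 1 * ‖x' - x‖ * 1 := by
        gcongr
        · rw [norm_star]; exact norm_cutter_le k
        · exact norm_cutter_le k
      _ = ‖x - x'‖ := by rw [one_mul, mul_one, norm_sub_rev]
  have h1 : ‖∫ θ in (0 : ℝ)..2 * Real.pi, f (gauge (Circle.exp θ) x')‖ ≤ C * ‖x - x'‖ := by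
    rw [hint f, norm_mul, hC]
    have : ‖(2 * Real.pi : ℂ)‖ = 2 * Real.pi := by
      rw [← Complex.ofReal_ofNat, ← Complex.ofReal_mul, Complex.norm_real,
        Real.norm_of_nonneg (by positivity)]
    rw [this, mul_assoc (2 * Real.pi)]
    exact mul_le_mul_of_nonneg_left
      ((hf1 y).trans (mul_le_mul_of_nonneg_left hy (norm_nonneg f))) (by positivity)
  have h2 : ‖∫ θ in (0 : ℝ)..2 * Real.pi, f (gauge (Circle.exp θ) (x - x'))‖ ≤ C * ‖x - x'‖ := by
    have := norm_integral_le_of_norm_le_const (a := 0) (b := 2 * Real.pi)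
      (f := fun θ : ℝ => f (gauge (Circle.exp θ) (x - x'))) (C := ‖f‖ * ‖x - x'‖) fun θ _ =>
        (hf1 _).trans (mul_le_mul_of_nonneg_left (norm_gauge_le _ _) (norm_nonneg f))
    refine this.trans (le_of_eq ?_)
    rw [sub_zero, abs_of_nonneg (by positivity), hC]
    ring
  have h3 : δ ≤ C * ‖x - x'‖ + C * ‖x - x'‖ := by
    have : ∫ θ in (0 : ℝ)..2 * Real.pi, f (gauge (Circle.exp θ) x)
        = (∫ θ in (0 : ℝ)..2 * Real.pi, f (gauge (Circle.exp θ) (x - x')))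
          + ∫ θ in (0 : ℝ)..2 * Real.pi, f (gauge (Circle.exp θ) x') := by
      rw [← integral_add ((hcont _).intervalIntegrable _ _) ((hcont _).intervalIntegrable _ _)]
      simp
    rw [hδ, this]
    exact (norm_add_le _ _).trans (add_le_add h2 h1)
  have h4 : (C + 1) * ‖x - x'‖ < δ / 2 := by
    have := mul_lt_mul_of_pos_left hd (show 0 < C + 1 by positivity)
    refine this.trans_le (le_of_eq ?_)
    field_simp
  nlinarith [norm_nonneg (x - x')]

end CuntzAlgebra

/-! ### Uniqueness of the pseudo-expectation -/

section Subrepresentation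

variable {A K : Type*} [CStarAlgebra A] [NormedAddCommGroup K] [InnerProductSpace ℂ K]
  [CompleteSpace K]

open ContinuousLinearMap in
/-- The restriction of a representation to an invariant subspace. -/
def StarAlgHom.subrepresentation (ρ : A →⋆ₐ[ℂ] (K →L[ℂ] K)) (H : Submodule ℂ K) [CompleteSpace H]
    (hH : ∀ a, ∀ x ∈ H, ρ a x ∈ H) : A →⋆ₐ[ℂ] (H →L[ℂ] H) where
  toFun a := adjoint H.subtypeL ∘L ρ a ∘L H.subtypeL
  map_one' := by
    ext x
    simp [Submodule.adjoint_subtypeL]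
  map_mul' a b := by
    ext x
    have : (H.orthogonalProjectionOnto (ρ b x) : K) = ρ b x :=
      Submodule.starProjection_eq_self_iff.mpr (hH b x x.2)
    simp [Submodule.adjoint_subtypeL, this]
  map_zero' := by ext x; simp
  map_add' a b := by ext x; simp
  commutes' c := by
    ext x
    simp [Submodule.adjoint_subtypeL, Algebra.algebraMap_eq_smul_one]
  map_star' a := by
    have hst : ρ (star a) = adjoint (ρ a) := map_star ρ a
    rw [star_eq_adjoint, adjoint_comp, adjoint_comp, adjoint_adjoint, hst]
    rfl

end Subrepresentation

namespace CuntzAlgebra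

variable {I : Type} [CStarAlgebra I] [PartialOrder I] [StarOrderedRing I] {κ : CuntzAlgebra →⋆ₐ[ℂ] I}

/-- If `ψ` looks like the vector state of an eigenvector of `s₀` and `d` implements the flip, then
`ψ (b d) = ψ ((s₀*ⁿ b s₁ⁿ) d)` for all `n`, and this tends to `0`. -/
theorem apply_mul_eq_zero_of_intertwine {ψ : I →L[ℂ] ℂ} (hψ : ψ ∈ stateSpace I) {z : ℂ}
    (hz : star z * z = 1) (h : ∀ x, ψ (x * κ (s 0)) = z * ψ x) {d : I}
    (hd : ∀ a, d * κ a = κ (flip a) * d) (b : CuntzAlgebra) : ψ (κ b * d) = 0 := by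
  set v := κ (s 0) with hv
  have h1 : ∀ x, ψ (star v * x * v) = ψ x := by
    intro x
    have : star v * x = star (star x * v) := by rw [star_mul, star_star]
    rw [h, this, map_star_of_mem_stateSpace hψ, h, map_star_of_mem_stateSpace hψ,
      star_mul', star_star]
    linear_combination ψ x * hz
  have h2 : ∀ (n : ℕ) x, ψ (star v ^ n * x * v ^ n) = ψ x := by
    intro n
    induction n with
    | zero => simp
    | succ n ih =>
      intro x
      have : star v ^ (n + 1) * x * v ^ (n + 1) = star v ^ n * (star v * x * v) * v ^ n := by
        rw [pow_succ, pow_succ']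
        simp only [mul_assoc]
      rw [this, ih, h1]
  have h3 : ∀ n : ℕ, d * v ^ n = κ (s 1) ^ n * d := by
    intro n
    rw [hv, ← map_pow, hd, map_pow, flip_s, map_pow]
    rfl
  have h4 : ∀ n : ℕ, ψ (κ b * d) = ψ (κ (star (s 0) ^ n * b * s 1 ^ n) * d) := by
    intro n
    rw [← h2 n, mul_assoc, mul_assoc, h3]
    simp only [map_mul, map_pow, map_star, mul_assoc, hv]
  have h5 : Filter.Tendsto (fun n : ℕ => ψ (κ (star (s 0) ^ n * b * s 1 ^ n) * d)) Filter.atTop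
      (nhds 0) := by
    have hc : Continuous fun x => ψ (κ x * d) := by
      have := map_continuous κ
      fun_prop
    have := (hc.tendsto 0).comp (tendsto_compress b (i := 0) (j := 1) (by decide))
    rw [map_zero, zero_mul, map_zero] at this
    exact this
  simp only [← h4] at h5
  exact tendsto_nhds_unique tendsto_const_nhds h5

theorem inner_gnsStarAlgHom {A : Type*} [CStarAlgebra A] [PartialOrder A]
    [StarOrderedRing A] (f : A →ₚ[ℂ] ℂ) (x : A) :
    inner ℂ (f.toPreGNS 1 : f.GNS) (f.gnsStarAlgHom x (f.toPreGNS 1 : f.GNS)) = f x := by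
  have h : f.gnsStarAlgHom x (f.toPreGNS 1 : f.GNS) = (f.toPreGNS x : f.GNS) := by
    refine (f.gnsNonUnitalStarAlgHom_apply_coe (a := x) (b := f.toPreGNS 1)).trans ?_
    simp
  rw [h, UniformSpace.Completion.inner_coe, f.preGNS_inner_def]
  simp

/-- If all matrix coefficients of `ρ d` vanish on the cyclic subspace generated by `𝒪₂` and `ξ`, where
`ρ` is a representation of an injective envelope, then `d = 0`: the compression of `ρ` to the cyclic
subspace is completely positive, injective and multiplicative on `𝒪₂`, and it kills `d`. By
injectivity it can be followed by a completely positive map back to the envelope so that the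
composition is the identity on `𝒪₂`, and by rigidity this composition is the identity. -/
theorem eq_zero_of_forall_inner_eq_zero (hκ : IsInjectiveEnvelope κ) {K : Type}
    [NormedAddCommGroup K] [InnerProductSpace ℂ K] [CompleteSpace K] (ρ : I →⋆ₐ[ℂ] (K →L[ℂ] K))
    {ξ : K} (hξ : ξ ≠ 0) {d : I}
    (h : ∀ a b, inner ℂ (ρ (κ a) ξ) (ρ d (ρ (κ b) ξ)) = 0) : d = 0 := by
  let τ : CuntzAlgebra →ₗ[ℂ] K :=
    { toFun := fun a => ρ (κ a) ξ
      map_add' := by simp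
      map_smul' := by simp }
  let H : Submodule ℂ K := (LinearMap.range τ).topologicalClosure
  have hHc : IsClosed (H : Set K) := Submodule.isClosed_topologicalClosure _
  have : CompleteSpace H := hHc.completeSpace_coe
  have hmem : ∀ a, ρ (κ a) ξ ∈ H := fun a => Submodule.le_topologicalClosure _ ⟨a, rfl⟩
  have hinv : ∀ a, ∀ x ∈ H, (ρ.comp κ) a x ∈ H := by
    intro a x hx
    have hcl : IsClosed {x | ρ (κ a) x ∈ H} := hHc.preimage (ρ (κ a)).continuous
    refine closure_minimal ?_ hcl hx
    rintro _ ⟨b, rfl⟩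
    have := hmem (a * b)
    rwa [map_mul, map_mul] at this
  have hξH : ξ ∈ H := by simpa using hmem 1
  have hHn : Nontrivial H := ⟨⟨ξ, hξH⟩, 0, fun h0 => hξ (congrArg Subtype.val h0)⟩
  have hker : ∀ x ∈ H, ∀ y ∈ H, inner ℂ x (ρ d y) = 0 := by
    intro x hx y hy
    have hcl : IsClosed {x | inner ℂ x (ρ d y) = 0} := isClosed_eq (by fun_prop) (by fun_prop)
    refine closure_minimal ?_ hcl hx
    rintro _ ⟨a, rfl⟩
    have hcl' : IsClosed {y | inner ℂ (ρ (κ a) ξ) (ρ d y) = 0} :=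
      isClosed_eq (by fun_prop) (by fun_prop)
    refine closure_minimal ?_ hcl' hy
    rintro _ ⟨b, rfl⟩
    exact h a b
  have hΘd : ρ.compression H.subtypeL d = 0 := by
    refine ContinuousLinearMap.ext fun y => ext_inner_left ℂ fun x => ?_
    rw [StarAlgHom.compression_apply]
    simp only [ContinuousLinearMap.coe_comp, Function.comp_apply,
      ContinuousLinearMap.adjoint_inner_right]
    exact (hker x x.2 y y.2).trans (inner_zero_right x).symm
  obtain ⟨η, -, hη⟩ := hκ.isInjective CuntzAlgebra (H →L[ℂ] H)
    ((ρ.comp κ).subrepresentation H hinv) (injective_of_nontrivial _)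
    κ.toCP (by rw [StarAlgHom.toCP_apply, map_one])
  let Ψ : I →CP I := CompletelyPositiveMap.compCP η (ρ.compression H.subtypeL)
  have hΨ : ∀ a, Ψ (κ a) = κ a := fun a => hη a
  rw [← hκ.rigid Ψ hΨ d]
  change η (ρ.compression H.subtypeL d) = 0
  rw [hΘd, map_zero]

/-- In an injective envelope of `𝒪₂`, zero is the only element which implements the flip. -/
theorem eq_zero_of_implements_flip (hκ : IsInjectiveEnvelope κ) {d : I}
    (hd : ∀ a, d * κ a = κ (flip a) * d) : d = 0 := by
  rcases subsingleton_or_nontrivial I with hI | hI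
  · exact Subsingleton.elim _ _
  obtain ⟨z, hz, ψ, hψ, h⟩ := exists_mem_stateSpace_of_isometry (v := κ (s 0)) (by
    rw [← map_star, ← map_mul, star_s_mul_s, if_pos rfl, map_one])
  have hψd := apply_mul_eq_zero_of_intertwine hψ hz h hd
  let f : I →ₚ[ℂ] ℂ := PositiveLinearMap.mk₀ ψ.toLinearMap hψ.2
  have hinner : ∀ x, inner ℂ (f.toPreGNS 1 : f.GNS) (f.gnsStarAlgHom x (f.toPreGNS 1 : f.GNS))
      = ψ x := inner_gnsStarAlgHom f
  refine eq_zero_of_forall_inner_eq_zero hκ f.gnsStarAlgHom (ξ := (f.toPreGNS 1 : f.GNS))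
    (fun h0 => ?_) fun a b => ?_
  · have := hinner 1
    rw [h0, inner_zero_left, hψ.1] at this
    exact zero_ne_one this
  · have h1 : f.gnsStarAlgHom (κ a) = ContinuousLinearMap.adjoint (f.gnsStarAlgHom (κ (star a))) := by
      rw [← ContinuousLinearMap.star_eq_adjoint, ← map_star, ← map_star, star_star]
    rw [h1, ContinuousLinearMap.adjoint_inner_left, ← mul_apply_eq_comp,
      ← mul_apply_eq_comp, ← map_mul, ← map_mul, hinner, mul_assoc, hd, ← mul_assoc, ← map_mul]
    exact hψd _

theorem existsUnique_isPseudoExpectation (hκ : IsInjectiveEnvelope κ) :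
    ∃! Φ : CrossedProduct flipAction →CP I,
      IsPseudoExpectation (CrossedProduct.incl flipAction) κ Φ := by
  have hE := CrossedProduct.isConditionalExpectation_expectation flipAction
  refine ⟨κ.toCP.compCP (CrossedProduct.expectation flipAction), ⟨?_, fun a => ?_⟩, fun Φ hΦ => ?_⟩
  · change κ (CrossedProduct.expectation flipAction 1) = 1
    rw [← map_one (CrossedProduct.incl flipAction), hE.map_incl, map_one]
  · change κ (CrossedProduct.expectation flipAction _) = κ a
    rw [hE.map_incl]
  set i := CrossedProduct.incl flipAction
  set u := CrossedProduct.translation flipAction flipGen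
  have hr : ∀ x a, Φ (x * i a) = Φ x * κ a := by
    intro x a
    rw [Φ.map_mul_of_map_star_mul_self hΦ.map_one (a := i a), hΦ.map_incl]
    rw [← map_star, ← map_mul, hΦ.map_incl, hΦ.map_incl, map_mul, map_star]
  have hst : ∀ x, Φ (star x) = star (Φ x) := fun x => map_star Φ x
  have hl : ∀ a x, Φ (i a * x) = κ a * Φ x := by
    intro a x
    have := congrArg star (hr (star x) (star a))
    rwa [← hst, star_mul, star_star, map_star, star_star, star_mul, hst, star_star, map_star,
      star_star] at this
  have hu : Φ u = 0 := eq_zero_of_implements_flip hκ fun a => by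
    rw [← hr, CrossedProduct.translation_mul_incl, hl, flipAction_flipGen]
  refine DFunLike.ext _ _ fun x => ?_
  change Φ x = κ (CrossedProduct.expectation flipAction x)
  conv_lhs => rw [eq_incl_add_incl_mul x]
  rw [map_add, hΦ.map_incl, hl, hu, mul_zero, add_zero]

end CuntzAlgebra

/-! ### The representation on `L²[-1,1]` -/

namespace IntervalRep

/-- Lebesgue measure on `[-1,1]`. -/
abbrev μI : Measure ℝ := volume.restrict (Set.Icc (-1 : ℝ) 1)

/-- The fixed points `1`, `-1` of the two expanding affine maps `t ↦ 2 t - ε i`. -/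
def ε : Fin 2 → ℝ := ![1, -1]

/-- The two halves `[0,1]`, `[-1,0]` of the interval. -/
def half (i : Fin 2) : Set ℝ := (fun t => 2 * t - ε i) ⁻¹' Set.Icc (-1) 1

theorem half_zero : half 0 = Set.Icc 0 1 := by
  ext t
  simp only [half, ε, Set.mem_preimage, Set.mem_Icc, Matrix.cons_val_zero]
  constructor <;> rintro ⟨h1, h2⟩ <;> constructor <;> linarith

theorem half_one : half 1 = Set.Icc (-1) 0 := by
  ext t
  simp only [half, ε, Set.mem_preimage, Set.mem_Icc, Matrix.cons_val_one, Matrix.cons_val_fin_one]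
  constructor <;> rintro ⟨h1, h2⟩ <;> constructor <;> linarith

theorem half_subset (i : Fin 2) : half i ⊆ Set.Icc (-1) 1 := by
  fin_cases i
  · exact half_zero ▸ Set.Icc_subset_Icc (by norm_num) le_rfl
  · exact half_one ▸ Set.Icc_subset_Icc le_rfl (by norm_num)

theorem measurableSet_half (i : Fin 2) : MeasurableSet (half i) := by
  have : Measurable fun t : ℝ => 2 * t - ε i := by fun_prop
  exact this measurableSet_Icc

theorem measurableEmbedding_affine {a : ℝ} (ha : a ≠ 0) (b : ℝ) :
    MeasurableEmbedding fun t : ℝ => a * t + b :=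
  ((Homeomorph.mulLeft₀ a ha).trans (Homeomorph.addRight b)).measurableEmbedding

theorem map_affine_volume {a : ℝ} (ha : a ≠ 0) (b : ℝ) :
    Measure.map (fun t : ℝ => a * t + b) volume = ENNReal.ofReal |a⁻¹| • volume := by
  have h : (fun t : ℝ => a * t + b) = (fun t => t + b) ∘ fun t => a * t := rfl
  rw [h, ← Measure.map_map (by fun_prop) (by fun_prop), Real.map_volume_mul_left ha,
    Measure.map_smul, map_add_right_eq_self]

theorem map_expand (i : Fin 2) :
    Measure.map (fun t => 2 * t - ε i) (volume.restrict (half i)) = (2⁻¹ : ENNReal) • μI := by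
  have he := measurableEmbedding_affine (two_ne_zero' ℝ) (-ε i)
  have h := he.restrict_map volume (Set.Icc (-1) 1)
  rw [map_affine_volume (two_ne_zero' ℝ), Measure.restrict_smul] at h
  have h2 : ENNReal.ofReal |(2 : ℝ)⁻¹| = 2⁻¹ := by
    rw [abs_of_pos (by norm_num), ENNReal.ofReal_inv_of_pos (by norm_num)]
    simp
  rw [h2] at h
  exact h.symm

theorem map_contract (i : Fin 2) :
    Measure.map (fun t => (t + ε i) / 2) μI = (2 : ENNReal) • volume.restrict (half i) := by
  have he := measurableEmbedding_affine (inv_ne_zero (two_ne_zero' ℝ)) (2⁻¹ * ε i)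
  have h := he.restrict_map volume (half i)
  rw [map_affine_volume (inv_ne_zero (two_ne_zero' ℝ)), Measure.restrict_smul, inv_inv] at h
  have h2 : ENNReal.ofReal |(2 : ℝ)| = 2 := by simp
  have h3 : (fun t : ℝ => 2⁻¹ * t + 2⁻¹ * ε i) = fun t => (t + ε i) / 2 := by
    ext t; ring
  have h4 : (fun t : ℝ => (t + ε i) / 2) ⁻¹' half i = Set.Icc (-1) 1 := by
    ext t
    simp only [half, Set.mem_preimage]
    rw [show 2 * ((t + ε i) / 2) - ε i = t by ring]
  rw [h2, h3, h4] at h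
  exact h.symm

theorem ae_expand (i : Fin 2) {P : ℝ → Prop} (h : ∀ᵐ t ∂μI, P t) :
    ∀ᵐ t ∂μI, t ∈ half i → P (2 * t - ε i) := by
  have h1 : ∀ᵐ t ∂Measure.map (fun t => 2 * t - ε i) (volume.restrict (half i)), P t := by
    rw [map_expand]
    exact Measure.ae_smul_measure h _
  have h2 := ae_of_ae_map (by fun_prop) h1
  exact ae_restrict_of_ae (ae_imp_of_ae_restrict h2)

/-- The function `√2 · f (2 t - ε i) · χ_{half i} (t)`. -/
def isoFun (i : Fin 2) (f : ℝ → ℂ) (t : ℝ) : ℂ :=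
  (√2 : ℂ) * (half i).indicator (fun t => f (2 * t - ε i)) t

theorem isoFun_congr (i : Fin 2) {f g : ℝ → ℂ} (h : f =ᵐ[μI] g) : isoFun i f =ᵐ[μI] isoFun i g := by
  filter_upwards [ae_expand i h] with t ht
  by_cases hm : t ∈ half i
  · simp [isoFun, hm, ht hm]
  · simp [isoFun, hm]

theorem eLpNorm_isoFun (i : Fin 2) {f : ℝ → ℂ} (hf : AEStronglyMeasurable f μI) :
    eLpNorm (isoFun i f) 2 μI = eLpNorm f 2 μI := by
  have h1 : isoFun i f = (√2 : ℂ) • (half i).indicator (f ∘ fun t => 2 * t - ε i) := rfl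
  have h2 : μI.restrict (half i) = volume.restrict (half i) := by
    rw [Measure.restrict_restrict (measurableSet_half i), Set.inter_eq_left.mpr (half_subset i)]
  rw [h1, eLpNorm_const_smul, eLpNorm_indicator_eq_eLpNorm_restrict (measurableSet_half i), h2,
    ← eLpNorm_map_measure (by rw [map_expand]; exact hf.smul_measure _) (by fun_prop), map_expand,
    eLpNorm_smul_measure_of_ne_top (by simp)]
  have h3 : ‖(√2 : ℂ)‖ₑ = 2 ^ ((1 : ENNReal) / 2).toReal := by
    rw [← Complex.coe_algebraMap, ← ofReal_norm, norm_algebraMap', Real.norm_of_nonneg (by positivity),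
      Real.sqrt_eq_rpow, ← ENNReal.ofReal_rpow_of_pos (by norm_num)]
    simp
  rw [h3, smul_eq_mul, ← mul_assoc, ← ENNReal.mul_rpow_of_nonneg _ _ (by positivity),
    ENNReal.mul_inv_cancel (by simp) (by simp), ENNReal.one_rpow, one_mul]

theorem memLp_isoFun (i : Fin 2) {f : ℝ → ℂ} (hf : MemLp f 2 μI) : MemLp (isoFun i f) 2 μI := by
  refine ⟨?_, (eLpNorm_isoFun i hf.1).trans_lt hf.2⟩
  have h : AEStronglyMeasurable (f ∘ fun t => 2 * t - ε i) (volume.restrict (half i)) := by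
    refine AEStronglyMeasurable.comp_measurable ?_ (by fun_prop)
    rw [map_expand]
    exact hf.1.smul_measure _
  have h2 : AEStronglyMeasurable ((half i).indicator (f ∘ fun t => 2 * t - ε i)) μI :=
    ((aestronglyMeasurable_indicator_iff (measurableSet_half i)).mpr h).mono_measure
      Measure.restrict_le_self
  exact h2.const_mul _

/-- The isometries `S i f (t) = √2 · f (2 t - ε i) · χ_{half i} (t)` of `L²[-1,1]`. -/
def S (i : Fin 2) : L2Interval →L[ℂ] L2Interval :=
  LinearMap.mkContinuous
    { toFun := fun f => (memLp_isoFun i (Lp.memLp f)).toLp _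
      map_add' := fun f g => by
        rw [← MemLp.toLp_add]
        refine MemLp.toLp_congr _ _ ((isoFun_congr i (Lp.coeFn_add f g)).trans (.of_forall fun t => ?_))
        by_cases hm : t ∈ half i <;> simp [isoFun, hm, mul_add]
      map_smul' := fun c f => by
        rw [RingHom.id_apply, ← MemLp.toLp_const_smul]
        refine MemLp.toLp_congr _ _ ((isoFun_congr i (Lp.coeFn_smul c f)).trans (.of_forall fun t => ?_))
        by_cases hm : t ∈ half i <;> simp [isoFun, hm, mul_left_comm] }
    1 fun f => by
      rw [one_mul]
      change ‖(memLp_isoFun i (Lp.memLp f)).toLp _‖ ≤ _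
      rw [Lp.norm_toLp, eLpNorm_isoFun i (Lp.memLp f).1, ← Lp.norm_def]

theorem coeFn_S (i : Fin 2) (f : L2Interval) : S i f =ᵐ[μI] isoFun i f :=
  MemLp.coeFn_toLp (memLp_isoFun i (Lp.memLp f))

theorem norm_S (i : Fin 2) (f : L2Interval) : ‖S i f‖ = ‖f‖ := by
  change ‖(memLp_isoFun i (Lp.memLp f)).toLp _‖ = _
  rw [Lp.norm_toLp, eLpNorm_isoFun i (Lp.memLp f).1, ← Lp.norm_def]

theorem ae_mem_half_iff : ∀ᵐ t ∂μI, (t ∈ half 0 ↔ t ∉ half 1) := by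
  have h0 : ∀ᵐ t ∂μI, t ≠ 0 := ae_restrict_of_ae (Measure.ae_ne volume 0)
  filter_upwards [h0, ae_restrict_mem measurableSet_Icc] with t ht hm
  rw [half_zero, half_one]
  simp only [Set.mem_Icc] at hm ⊢
  constructor
  · rintro ⟨h1, -⟩ ⟨-, h2⟩
    exact ht (le_antisymm h2 h1)
  · intro h
    refine ⟨?_, hm.2⟩
    by_contra hlt
    exact h ⟨hm.1, (not_le.mp hlt).le⟩

theorem inner_S_zero_S_one (f g : L2Interval) : inner ℂ (S 0 f) (S 1 g) = 0 := by
  rw [L2.inner_def]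
  refine integral_eq_zero_of_ae ?_
  filter_upwards [coeFn_S 0 f, coeFn_S 1 g, ae_mem_half_iff] with t h0 h1 h
  rw [h0, h1]
  by_cases hm : t ∈ half 1
  · simp [isoFun, mt h.mp (not_not.mpr hm)]
  · simp [isoFun, hm]

theorem exists_eq_S_add_S (h : L2Interval) : ∃ g : Fin 2 → L2Interval, h = S 0 (g 0) + S 1 (g 1) := by
  have hmem : ∀ i, MemLp (fun t => (√2 : ℂ)⁻¹ * h ((t + ε i) / 2)) 2 μI := by
    intro i
    refine MemLp.const_mul ?_ _
    refine MemLp.comp_of_map (f := fun t => (t + ε i) / 2) ?_ (by fun_prop)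
    rw [map_contract]
    exact ((Lp.memLp h).mono_measure (Measure.restrict_mono (half_subset i) le_rfl)).smul_measure
      (by simp)
  refine ⟨fun i => (hmem i).toLp _, Lp.ext ?_⟩
  have hS : ∀ i, S i ((hmem i).toLp _) =ᵐ[μI] (half i).indicator h := by
    intro i
    refine (coeFn_S i _).trans ((isoFun_congr i (MemLp.coeFn_toLp (hmem i))).trans
      (.of_forall fun t => ?_))
    by_cases hm : t ∈ half i
    · simp [isoFun, hm]
    · simp [isoFun, hm]
  filter_upwards [Lp.coeFn_add (S 0 ((hmem 0).toLp _)) (S 1 ((hmem 1).toLp _)), hS 0, hS 1,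
    ae_mem_half_iff] with t h1 h2 h3 h4
  rw [h1, Pi.add_apply, h2, h3]
  by_cases hm : t ∈ half 1
  · simp [mt h4.mp (not_not.mpr hm), hm]
  · simp [h4.mpr hm, hm]

open ContinuousLinearMap in
theorem isCuntzPair_S : IsCuntzPair S := by
  have hiso : ∀ i, star (S i) * S i = 1 := fun i =>
    (norm_map_iff_adjoint_comp_self (S i)).mp (norm_S i)
  have h01 : star (S 0) * S 1 = 0 := by
    refine ContinuousLinearMap.ext fun g => ext_inner_left ℂ fun f => ?_
    rw [mul_apply_eq_comp, star_eq_adjoint, adjoint_inner_right, inner_S_zero_S_one]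
    exact (inner_zero_right f).symm
  have h10 : star (S 1) * S 0 = 0 := by simpa using congrArg star h01
  refine ⟨hiso, ContinuousLinearMap.ext fun h => ?_⟩
  obtain ⟨g, rfl⟩ := exists_eq_S_add_S h
  have key : (S 0 * star (S 0) + S 1 * star (S 1)) * S 0 = S 0 := by
    rw [add_mul, mul_assoc, mul_assoc, hiso, h10, mul_one, mul_zero, add_zero]
  have key' : (S 0 * star (S 0) + S 1 * star (S 1)) * S 1 = S 1 := by
    rw [add_mul, mul_assoc, mul_assoc, hiso, h01, mul_one, mul_zero, zero_add]
  rw [map_add, one_apply_eq_self, ← mul_apply_eq_comp, ← mul_apply_eq_comp, key, key']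

/-- The representation of `𝒪₂` on `L²[-1,1]` determined by the isometries `S i`. -/
def rep : CuntzAlgebra →⋆ₐ[ℂ] (L2Interval →L[ℂ] L2Interval) := CuntzAlgebra.lift S isCuntzPair_S

theorem rep_s (i : Fin 2) : rep (CuntzAlgebra.s i) = S i := CuntzAlgebra.lift_s _ _ i

/-! ### The reflection -/

theorem measurePreserving_neg : MeasurePreserving (fun t : ℝ => -t) μI μI := by
  have h := (Measure.measurePreserving_neg (volume : Measure ℝ)).restrict_preimage
    (measurableSet_Icc (a := (-1 : ℝ)) (b := 1))
  have h2 : (Neg.neg ⁻¹' Set.Icc (-1) 1 : Set ℝ) = Set.Icc (-1) 1 := by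
    ext t
    simp only [Set.mem_preimage, Set.mem_Icc]
    constructor <;> rintro ⟨h1, h2⟩ <;> constructor <;> linarith
  rwa [h2] at h

/-- The reflection `f ↦ f (-·)` of `L²[-1,1]`. -/
def refl : L2Interval →L[ℂ] L2Interval :=
  (Lp.compMeasurePreservingₗᵢ ℂ _ measurePreserving_neg).toContinuousLinearMap

theorem coeFn_refl (f : L2Interval) : refl f =ᵐ[μI] fun t => f (-t) :=
  Lp.coeFn_compMeasurePreserving f measurePreserving_neg

theorem ae_neg {P : ℝ → Prop} (h : ∀ᵐ t ∂μI, P t) : ∀ᵐ t ∂μI, P (-t) :=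
  measurePreserving_neg.quasiMeasurePreserving.ae h

theorem refl_mul_refl : refl * refl = 1 := by
  refine ContinuousLinearMap.ext fun f => Lp.ext ?_
  filter_upwards [coeFn_refl (refl f), ae_neg (coeFn_refl f)] with t h1 h2
  change refl (refl f) t = f t
  rw [h1, h2, neg_neg]

open ContinuousLinearMap in
theorem star_refl : star refl = refl := by
  have h : star refl * refl = 1 := (norm_map_iff_adjoint_comp_self refl).mp
    (Lp.compMeasurePreservingₗᵢ ℂ _ measurePreserving_neg).norm_map
  calc star refl = star refl * refl * refl := by rw [mul_assoc, refl_mul_refl, mul_one]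
    _ = refl := by rw [h, one_mul]

/-- The reflection as a unitary. -/
def reflUnitary : unitary (L2Interval →L[ℂ] L2Interval) :=
  ⟨refl, by rw [Unitary.mem_iff, star_refl, refl_mul_refl]; exact ⟨rfl, rfl⟩⟩

theorem refl_S (i : Fin 2) (f : L2Interval) : refl (S i f) = S (Equiv.swap 0 1 i) (refl f) := by
  have hε : ε (Equiv.swap 0 1 i) = -ε i := by
    fin_cases i <;> simp [ε]
  refine Lp.ext ?_
  filter_upwards [coeFn_refl (S i f), ae_neg (coeFn_S i f), coeFn_S (Equiv.swap 0 1 i) (refl f),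
    isoFun_congr (Equiv.swap 0 1 i) (coeFn_refl f)] with t h1 h2 h3 h4
  rw [h1, h2, h3, h4]
  have hm : -t ∈ half i ↔ t ∈ half (Equiv.swap 0 1 i) := by
    simp only [half, Set.mem_preimage, Set.mem_Icc, hε]
    constructor <;> rintro ⟨h1, h2⟩ <;> constructor <;> linarith
  by_cases ht : t ∈ half (Equiv.swap 0 1 i)
  · have : 2 * -t - ε i = -(2 * t - -ε i) := by ring
    simp only [isoFun, hε, Set.indicator_of_mem ht, Set.indicator_of_mem (hm.mpr ht), this]
  · simp [isoFun, ht, mt hm.mp ht]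

theorem rep_flip (x : CuntzAlgebra) : rep (CuntzAlgebra.flip x) = refl * rep x * star refl := by
  have h : rep.comp CuntzAlgebra.flipHom
      = ((Unitary.conjStarAlgAut ℂ _ reflUnitary : _ ≃⋆ₐ[ℂ] _) : _ →⋆ₐ[ℂ] _).comp rep :=
    CuntzAlgebra.hom_ext fun i => by
      change rep (CuntzAlgebra.flipHom (CuntzAlgebra.s i)) = refl * rep (CuntzAlgebra.s i) * star refl
      rw [CuntzAlgebra.flipHom_s, rep_s, rep_s, star_refl]
      refine ContinuousLinearMap.ext fun f => ?_
      rw [mul_apply_eq_comp, mul_apply_eq_comp, refl_S, ← mul_apply_eq_comp refl, refl_mul_refl]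
      rfl
  exact DFunLike.congr_fun h x

end IntervalRep

/-! ### Irreducibility of the representation on `L²[-1,1]` -/

/-- An integrable function on the line whose distribution function vanishes is zero. -/
theorem MeasureTheory.Integrable.ae_eq_zero_of_forall_setIntegral_Iic_eq_zero {μ : Measure ℝ}
    {f : ℝ → ℂ} (hf : Integrable f μ) (huniv : ∫ t, f t ∂μ = 0)
    (h : ∀ x, ∫ t in Set.Iic x, f t ∂μ = 0) : f =ᵐ[μ] 0 := by
  refine hf.ae_eq_zero_of_forall_setIntegral_eq_zero fun s hs hs' => ?_
  clear hs'
  induction s, hs using MeasurableSpace.induction_on_inter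
    (borel_eq_generateFrom_Iic ℝ ▸ (inferInstance : BorelSpace ℝ).measurable_eq) isPiSystem_Iic with
  | empty => simp
  | basic t ht =>
    obtain ⟨x, rfl⟩ := ht
    exact h x
  | compl t ht ih => rw [setIntegral_compl ht hf, huniv, ih, sub_zero]
  | iUnion g hd hm ih => simp [integral_iUnion hm hd hf.integrableOn, ih]

namespace IntervalRep

/-- The indicator function of `[-1,x]` in `L²[-1,1]`. -/
def chi (x : ℝ) : L2Interval :=
  indicatorConstLp 2 (measurableSet_Iic (a := x)) (measure_ne_top μI _) 1

theorem coeFn_chi (x : ℝ) : chi x =ᵐ[μI] (Set.Iic x).indicator fun _ => 1 := indicatorConstLp_coeFn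

theorem inner_chi (x : ℝ) (f : L2Interval) : inner ℂ (chi x) f = ∫ t in Set.Iic x, f t ∂μI :=
  L2.inner_indicatorConstLp_one _ _ f

theorem exists_norm_chi_le : ∃ C, ∀ x, ‖chi x‖ ≤ C := by
  refine ⟨‖(1 : ℂ)‖ * μI.real Set.univ ^ (1 / (2 : ENNReal).toReal), fun x => ?_⟩
  refine norm_indicatorConstLp_le.trans ?_
  gcongr
  · exact measure_ne_top μI _
  · exact Set.subset_univ _

/-- Self-similarity of `chi x` in the left half of the interval. -/
theorem S_one_chi {x : ℝ} (hx : x ≤ 0) : S 1 (chi (2 * x + 1)) = (√2 : ℂ) • chi x := by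
  refine Lp.ext ?_
  filter_upwards [coeFn_S 1 (chi (2 * x + 1)), isoFun_congr 1 (coeFn_chi (2 * x + 1)),
    Lp.coeFn_smul (√2 : ℂ) (chi x), coeFn_chi x, ae_restrict_mem measurableSet_Icc] with t h1 h2 h3 h4 ht
  rw [h1, h2, h3, Pi.smul_apply, h4, isoFun, smul_eq_mul]
  congr 1
  have hm : t ∈ half 1 ↔ t ≤ 0 := by rw [half_one]; exact and_iff_right ht.1
  have hε : ε 1 = -1 := rfl
  by_cases h : t ≤ x
  · rw [Set.indicator_of_mem (hm.mpr (h.trans hx)), Set.indicator_of_mem (s := Set.Iic x) h,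
      Set.indicator_of_mem (by rw [Set.mem_Iic, hε]; linarith)]
  · rw [Set.indicator_of_notMem (s := Set.Iic x) h, Set.indicator_apply_eq_zero]
    intro _
    rw [Set.indicator_of_notMem (by rw [Set.mem_Iic, hε]; intro h'; exact h (by linarith))]

/-- Self-similarity of `chi x` in the right half of the interval. -/
theorem S_zero_chi {x : ℝ} (hx : 0 ≤ x) :
    S 0 (chi (2 * x - 1)) = (√2 : ℂ) • (chi x - chi 0) := by
  refine Lp.ext ?_
  filter_upwards [coeFn_S 0 (chi (2 * x - 1)), isoFun_congr 0 (coeFn_chi (2 * x - 1)),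
    Lp.coeFn_smul (√2 : ℂ) (chi x - chi 0), Lp.coeFn_sub (chi x) (chi 0), coeFn_chi x, coeFn_chi 0,
    ae_restrict_mem measurableSet_Icc, ae_mem_half_iff] with t h1 h2 h3 h4 h5 h6 ht hh
  rw [h1, h2, h3, Pi.smul_apply, h4, Pi.sub_apply, h5, h6, isoFun, smul_eq_mul]
  congr 1
  have hm : t ∈ half 0 ↔ ¬ t ≤ 0 := by
    rw [hh, half_one]
    exact not_congr (and_iff_right ht.1)
  have hε : ε 0 = 1 := rfl
  by_cases h0 : t ≤ 0
  · rw [Set.indicator_of_notMem (fun h => hm.mp h h0), Set.indicator_of_mem (s := Set.Iic x) (h0.trans hx),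
      Set.indicator_of_mem (s := Set.Iic 0) h0, sub_self]
  · rw [Set.indicator_of_mem (hm.mpr h0), Set.indicator_of_notMem (s := Set.Iic 0) h0, sub_zero]
    by_cases h : t ≤ x
    · rw [Set.indicator_of_mem (s := Set.Iic x) h,
        Set.indicator_of_mem (by rw [Set.mem_Iic, hε]; linarith)]
    · rw [Set.indicator_of_notMem (s := Set.Iic x) h,
        Set.indicator_of_notMem (by rw [Set.mem_Iic, hε]; intro h'; exact h (by linarith))]

/-- The constant function `1`. -/
def one : L2Interval := chi 1

theorem coeFn_one : one =ᵐ[μI] fun _ => 1 := by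
  filter_upwards [coeFn_chi 1, ae_restrict_mem measurableSet_Icc] with t h ht
  rw [one, h, Set.indicator_of_mem (s := Set.Iic 1) ht.2]

theorem inner_one (f : L2Interval) : inner ℂ one f = ∫ t, f t ∂μI := by
  rw [one, inner_chi, ← integral_indicator measurableSet_Iic]
  refine integral_congr_ae ?_
  filter_upwards [ae_restrict_mem measurableSet_Icc] with t ht
  rw [Set.indicator_of_mem (s := Set.Iic 1) ht.2]

theorem norm_one_sq : ‖one‖ ^ 2 = 2 := by
  have h : inner ℂ one one = (2 : ℂ) := by
    rw [inner_one, integral_congr_ae coeFn_one]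
    simp [measureReal_def]
    norm_num
  rw [inner_self_eq_norm_sq_to_K] at h
  exact Complex.ofReal_injective (by simpa using h)

theorem one_ne_zero' : one ≠ 0 := fun h => by simpa [h] using norm_one_sq

theorem sqrt_two_ne_zero : (√2 : ℂ) ≠ 0 := by simp

theorem S_one_one : S 1 one = (√2 : ℂ) • chi 0 := by
  simpa [one] using S_one_chi le_rfl

theorem sqrt_two_smul_one : (√2 : ℂ) • one = S 0 one + S 1 one := by
  have h := S_zero_chi zero_le_one
  rw [show (2 * 1 - 1 : ℝ) = 1 by norm_num] at h
  rw [S_one_one, one, h, smul_sub, sub_add_cancel]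

theorem star_S_one (i : Fin 2) : star (S i) one = (√2 : ℂ)⁻¹ • one := by
  have h : star (S i) ((√2 : ℂ) • one) = one := by
    rw [sqrt_two_smul_one, map_add, ← mul_apply_eq_comp, ← mul_apply_eq_comp,
      isCuntzPair_S.star_mul, isCuntzPair_S.star_mul]
    fin_cases i <;> simp
  rw [map_smul] at h
  rw [eq_inv_smul_iff₀ sqrt_two_ne_zero, h]

theorem norm_star_S_le (i : Fin 2) (f : L2Interval) : ‖star (S i) f‖ ≤ ‖f‖ := by
  have h : ‖star (S i)‖ ≤ 1 := by
    rw [ContinuousLinearMap.star_eq_adjoint, LinearIsometryEquiv.norm_map]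
    exact (S i).opNorm_le_bound zero_le_one fun f => by rw [norm_S, one_mul]
  simpa using (star (S i)).le_of_opNorm_le h f

/-- A space of functions of mean zero which is invariant under the adjoints of the isometries is
zero: the self-similarity of the functions `chi x` shows that the coefficients `⟪chi x, f⟫` are
bounded by `C · 2 ^ (-n / 2) · ‖f‖` for every `n`. -/
theorem eq_zero_of_forall_inner_one_eq_zero {V : Submodule ℂ L2Interval}
    (hV : ∀ i, ∀ f ∈ V, star (S i) f ∈ V) (h1 : ∀ f ∈ V, inner ℂ one f = 0) {f : L2Interval}
    (hf : f ∈ V) : f = 0 := by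
  obtain ⟨C, hC⟩ := exists_norm_chi_le
  have hSi : ∀ (i : Fin 2) (g f : L2Interval), inner ℂ (S i g) f = inner ℂ g (star (S i) f) :=
    fun i g f => by
      rw [ContinuousLinearMap.star_eq_adjoint, ContinuousLinearMap.adjoint_inner_right]
  have hscale : ∀ x y : ℂ, √2 * x = y → x = (√2 : ℂ)⁻¹ * y := fun x y h => by
    rw [← h, inv_mul_cancel_left₀ sqrt_two_ne_zero]
  have hneg : ∀ x ≤ 0, ∀ f : L2Interval,
      inner ℂ (chi x) f = (√2 : ℂ)⁻¹ * inner ℂ (chi (2 * x + 1)) (star (S 1) f) := by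
    intro x hx f
    refine hscale _ _ ?_
    rw [← hSi, S_one_chi hx, inner_smul_left, Complex.conj_ofReal]
  have hzero : ∀ f ∈ V, inner ℂ (chi 0) f = 0 := fun f hf => by
    have h := h1 _ (hV 1 f hf)
    rw [hneg 0 le_rfl, show (2 * 0 + 1 : ℝ) = 1 by norm_num]
    exact mul_eq_zero_of_right _ h
  have hpos : ∀ x, 0 ≤ x → ∀ f ∈ V,
      inner ℂ (chi x) f = (√2 : ℂ)⁻¹ * inner ℂ (chi (2 * x - 1)) (star (S 0) f) := by
    intro x hx f hf
    refine hscale _ _ ?_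
    rw [← hSi, S_zero_chi hx, inner_smul_left, Complex.conj_ofReal, inner_sub_left, hzero f hf,
      sub_zero]
  have key : ∀ n : ℕ, ∀ f ∈ V, ∀ x, ‖inner ℂ (chi x) f‖ ≤ C * (√2)⁻¹ ^ n * ‖f‖ := by
    intro n
    induction n with
    | zero =>
      intro f _ x
      rw [pow_zero, mul_one]
      exact (norm_inner_le_norm _ _).trans (by gcongr; exact hC x)
    | succ n ih =>
      have hC0 : 0 ≤ C := (norm_nonneg _).trans (hC 0)
      have hstep : ∀ (i : Fin 2), ∀ f ∈ V, ∀ y,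
          ‖(√2 : ℂ)⁻¹ * inner ℂ (chi y) (star (S i) f)‖ ≤ C * (√2)⁻¹ ^ (n + 1) * ‖f‖ := by
        intro i f hf y
        rw [norm_mul, norm_inv, Complex.norm_of_nonneg (by positivity)]
        calc (√2)⁻¹ * ‖inner ℂ (chi y) (star (S i) f)‖
            ≤ (√2)⁻¹ * (C * (√2)⁻¹ ^ n * ‖f‖) := by
              gcongr
              refine (ih _ (hV i f hf) y).trans ?_
              gcongr
              exact norm_star_S_le i f
          _ = C * (√2)⁻¹ ^ (n + 1) * ‖f‖ := by ring
      intro f hf x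
      rcases le_total x 0 with hx | hx
      · rw [hneg x hx]
        exact hstep 1 f hf _
      · rw [hpos x hx f hf]
        exact hstep 0 f hf _
  have hchi : ∀ x, inner ℂ (chi x) f = 0 := fun x => by
    have hlim : Filter.Tendsto (fun n : ℕ => C * (√2)⁻¹ ^ n * ‖f‖) Filter.atTop (nhds 0) := by
      have h := tendsto_pow_atTop_nhds_zero_of_lt_one (r := (√2)⁻¹) (by positivity)
        (inv_lt_one_of_one_lt₀ (by rw [Real.lt_sqrt] <;> norm_num))
      simpa using (h.const_mul C).mul_const ‖f‖
    exact norm_le_zero_iff.mp (ge_of_tendsto' hlim fun n => key n f hf x)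
  have hint : Integrable f μI := (Lp.memLp f).integrable (by norm_num)
  refine (Lp.eq_zero_iff_ae_eq_zero).mpr
    (hint.ae_eq_zero_of_forall_setIntegral_Iic_eq_zero ?_ fun x => ?_)
  · rw [← inner_one]
    exact h1 f hf
  · rw [← inner_chi]
    exact hchi x

theorem isIrreducibleRepresentation_rep : IsIrreducibleRepresentation rep := by
  refine ⟨⟨⟨one, 0, one_ne_zero'⟩⟩, fun K hK hinv => ?_⟩
  have : CompleteSpace K := hK.completeSpace_coe
  have hKstar : ∀ i, ∀ f ∈ K, star (S i) f ∈ K := fun i f hf => by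
    rw [← rep_s, ← map_star]
    exact hinv _ f hf
  have hoS : ∀ i, ∀ f ∈ Kᗮ, star (S i) f ∈ Kᗮ := fun i f hf => by
    rw [Submodule.mem_orthogonal] at hf ⊢
    intro g hg
    rw [ContinuousLinearMap.star_eq_adjoint, ContinuousLinearMap.adjoint_inner_right, ← rep_s]
    exact hf _ (hinv _ g hg)
  -- The projection of `one` is again a common eigenvector of the adjoints, hence a multiple of `one`.
  set g := K.starProjection one with hg
  have hgK : g ∈ K := Submodule.starProjection_apply_mem K one
  have hgS : ∀ i, star (S i) g = (√2 : ℂ)⁻¹ • g := by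
    intro i
    rw [hg, ← map_smul, ← star_S_one i]
    refine (Submodule.eq_starProjection_of_mem_orthogonal (hKstar i _ hgK) ?_).symm
    rw [← map_sub]
    exact hoS i _ (Submodule.sub_starProjection_mem_orthogonal one)
  obtain ⟨c, hc⟩ : ∃ c : ℂ, inner ℂ one (g - c • one) = 0 := by
    have h2 : (inner ℂ one one : ℂ) ≠ 0 := by simpa using one_ne_zero'
    refine ⟨inner ℂ one g / inner ℂ one one, ?_⟩
    rw [inner_sub_right, inner_smul_right, div_mul_cancel₀ _ h2, sub_self]
  have hgc : g = c • one := by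
    refine sub_eq_zero.mp (eq_zero_of_forall_inner_one_eq_zero (V := ℂ ∙ (g - c • one)) ?_ ?_
      (Submodule.mem_span_singleton_self _))
    · intro i f hf
      obtain ⟨a, rfl⟩ := Submodule.mem_span_singleton.mp hf
      have : star (S i) (a • (g - c • one)) = (√2 : ℂ)⁻¹ • a • (g - c • one) := by
        rw [map_smul, map_sub, hgS, map_smul, star_S_one, smul_comm c, ← smul_sub, smul_comm a]
      rw [this]
      exact Submodule.smul_mem _ _ hf
    · intro f hf
      obtain ⟨a, rfl⟩ := Submodule.mem_span_singleton.mp hf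
      rw [inner_smul_right, hc, mul_zero]
  by_cases h0 : c = 0
  · left
    refine (Submodule.eq_bot_iff K).mpr fun f hf =>
      eq_zero_of_forall_inner_one_eq_zero hKstar (fun f hf => ?_) hf
    have := Submodule.starProjection_inner_eq_zero (K := K) one f hf
    rwa [← hg, hgc, h0, zero_smul, sub_zero] at this
  · right
    have h1K : one ∈ K := by
      have := K.smul_mem c⁻¹ hgK
      rwa [hgc, smul_smul, inv_mul_cancel₀ h0, one_smul] at this
    refine (Submodule.orthogonal_eq_bot_iff).mp ((Submodule.eq_bot_iff _).mpr fun f hf =>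
      eq_zero_of_forall_inner_one_eq_zero hoS (fun f hf => ?_) hf)
    exact (Submodule.mem_orthogonal _ _).mp hf _ h1K

end IntervalRep

/-! ### A flip-invariant pure state with two extensions -/

section VectorState

variable {A : Type*} [CStarAlgebra A] [PartialOrder A] [StarOrderedRing A]
  {H : Type*} [NormedAddCommGroup H] [InnerProductSpace ℂ H] [CompleteSpace H]

/-- The vector functional `a ↦ ⟪ξ, ρ a ξ⟫`. -/
def StarAlgHom.vectorFunctional (ρ : A →⋆ₐ[ℂ] (H →L[ℂ] H)) (ξ : H) : A →L[ℂ] ℂ :=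
  LinearMap.mkContinuous
    { toFun := fun a => inner ℂ ξ (ρ a ξ)
      map_add' := fun a b => by rw [map_add, add_apply, inner_add_right]
      map_smul' := fun c a => by rw [map_smul, smul_apply, inner_smul_right]; rfl }
    (‖ξ‖ * ‖ξ‖) fun a => by
      calc ‖inner ℂ ξ (ρ a ξ)‖ ≤ ‖ξ‖ * (‖ρ a‖ * ‖ξ‖) :=
            (norm_inner_le_norm _ _).trans (by gcongr; exact (ρ a).le_opNorm ξ)
        _ ≤ ‖ξ‖ * (‖a‖ * ‖ξ‖) := by gcongr; exact NonUnitalStarAlgHom.norm_apply_le ρ a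
        _ = ‖ξ‖ * ‖ξ‖ * ‖a‖ := by ring

theorem StarAlgHom.vectorFunctional_apply (ρ : A →⋆ₐ[ℂ] (H →L[ℂ] H)) (ξ : H) (a : A) :
    ρ.vectorFunctional ξ a = inner ℂ ξ (ρ a ξ) := rfl

theorem StarAlgHom.vectorFunctional_mem_stateSpace (ρ : A →⋆ₐ[ℂ] (H →L[ℂ] H)) {ξ : H}
    (hξ : ‖ξ‖ = 1) : ρ.vectorFunctional ξ ∈ stateSpace A := by
  refine mem_stateSpace_of_norm_le_one ?_ ?_
  · rw [vectorFunctional_apply, map_one, one_apply_eq_self, inner_self_eq_norm_sq_to_K, hξ]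
    simp
  · exact (LinearMap.mkContinuous_norm_le _ (by positivity) _).trans (by rw [hξ, one_mul])

end VectorState

namespace CuntzAlgebra

/-- The element `1 - (s 0 + s 1) / √2`; a vector is annihilated by it if it is fixed by the isometry
`(s 0 + s 1) / √2`. -/
def gap : CuntzAlgebra := 1 - (√2 : ℂ)⁻¹ • (s 0 + s 1)

variable {ψ : CuntzAlgebra →L[ℂ] ℂ}

theorem apply_mul_star_s (hψ : ψ ∈ stateSpace CuntzAlgebra) (h : ψ (star gap * gap) = 0) (i : Fin 2)
    (a : CuntzAlgebra) : ψ (a * star (s i)) = (√2 : ℂ)⁻¹ * ψ a := by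
  have h1 := apply_mul_eq_zero_of_mem_stateSpace hψ h (a * star (s i))
  have h2 : star (s i) * (s 0 + s 1) = 1 := by
    rw [mul_add, star_s_mul_s, star_s_mul_s]
    fin_cases i <;> simp
  rw [gap, mul_sub, mul_one, mul_smul_comm, mul_assoc, h2, mul_one, map_sub, map_smul,
    sub_eq_zero] at h1
  exact h1

theorem apply_s_mul (hψ : ψ ∈ stateSpace CuntzAlgebra) (h : ψ (star gap * gap) = 0) (i : Fin 2)
    (a : CuntzAlgebra) : ψ (s i * a) = (√2 : ℂ)⁻¹ * ψ a := by
  have h1 : s i * a = star (star a * star (s i)) := by rw [star_mul, star_star, star_star]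
  rw [h1, map_star_of_mem_stateSpace hψ, apply_mul_star_s hψ h, map_star_of_mem_stateSpace hψ,
    star_mul, star_star, mul_comm, star_inv₀]
  congr 2
  exact Complex.conj_ofReal _

/-- There is at most one state of `𝒪₂` that vanishes on `star gap * gap`. -/
theorem eq_of_apply_star_gap_mul_gap_eq_zero {ψ' : CuntzAlgebra →L[ℂ] ℂ}
    (hψ : ψ ∈ stateSpace CuntzAlgebra) (h : ψ (star gap * gap) = 0)
    (hψ' : ψ' ∈ stateSpace CuntzAlgebra) (h' : ψ' (star gap * gap) = 0) : ψ = ψ' := by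
  let M : Submodule ℂ CuntzAlgebra := LinearMap.eqLocus (ψ : CuntzAlgebra →ₗ[ℂ] ℂ) ψ'
  have hM : Dense (M : Set CuntzAlgebra) := dense_of_forall_word_mem M fun m n a b ha hb => by
    change ψ (a * star b) = ψ' (a * star b)
    induction ha with
    | one =>
      induction hb with
      | one => rw [star_one, mul_one, hψ.1, hψ'.1]
      | s_mul i _ ih =>
        rw [star_mul, ← mul_assoc, apply_mul_star_s hψ h, apply_mul_star_s hψ' h', ih]
    | s_mul i _ ih => rw [mul_assoc, apply_s_mul hψ h, apply_s_mul hψ' h', ih]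
  exact ContinuousLinearMap.ext fun x => congrFun (Continuous.ext_on hM ψ.continuous ψ'.continuous
    fun x hx => hx) x

/-- A state of `𝒪₂` that vanishes on `star gap * gap` is pure: so do the states of which it is a
convex combination. -/
theorem mem_pureStates_of_apply_star_gap_mul_gap_eq_zero (hψ : ψ ∈ stateSpace CuntzAlgebra)
    (h : ψ (star gap * gap) = 0) : ψ ∈ pureStates CuntzAlgebra := by
  refine ⟨hψ, fun ψ₁ h₁ ψ₂ h₂ hseg => ?_⟩
  obtain ⟨a, b, ha, hb, -, rfl⟩ := hseg
  refine eq_of_apply_star_gap_mul_gap_eq_zero h₁ ?_ hψ h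
  have hq : 0 ≤ star gap * gap := star_mul_self_nonneg _
  have e₁ := h₁.2 _ hq
  have e₂ := h₂.2 _ hq
  have hadd : a • ψ₁ (star gap * gap) + b • ψ₂ (star gap * gap) = 0 := h
  rw [add_eq_zero_iff_of_nonneg (smul_nonneg ha.le e₁) (smul_nonneg hb.le e₂)] at hadd
  exact (smul_eq_zero.mp hadd.1).resolve_left ha.ne'

end CuntzAlgebra

namespace IntervalRep

open CuntzAlgebra

theorem rep_gap_one : rep gap one = 0 := by
  rw [gap, map_sub, map_one, map_smul, map_add, rep_s, rep_s, sub_apply, smul_apply, add_apply,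
    ← sqrt_two_smul_one, smul_smul, inv_mul_cancel₀ sqrt_two_ne_zero, one_smul]
  exact sub_self one

theorem refl_one : refl one = one := by
  refine Lp.ext ?_
  filter_upwards [coeFn_refl one, coeFn_one, ae_neg coeFn_one] with t h1 h2 h3
  rw [h1, h2, h3]

/-- The unit vector `1 / √2`. -/
def unitVector : L2Interval := (√2 : ℂ)⁻¹ • one

theorem norm_unitVector : ‖unitVector‖ = 1 := by
  have h : ‖one‖ = √2 := by rw [← norm_one_sq, Real.sqrt_sq (norm_nonneg _)]
  rw [unitVector, norm_smul, h, norm_inv, Complex.norm_of_nonneg (by positivity),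
    inv_mul_cancel₀ (by positivity)]

theorem vectorFunctional_mem_pureStates :
    rep.vectorFunctional unitVector ∈ pureStates CuntzAlgebra := by
  refine mem_pureStates_of_apply_star_gap_mul_gap_eq_zero
    (rep.vectorFunctional_mem_stateSpace norm_unitVector) ?_
  rw [StarAlgHom.vectorFunctional_apply, map_mul, mul_apply_eq_comp, unitVector, map_smul,
    rep_gap_one, smul_zero, map_zero, inner_zero_right]

/-- For a unitary `v` with `v ^ 2 = 1`, the representation of `ℤ/2` that maps the generator to `v`. -/
def involutionRep {B : Type*} [CStarAlgebra B] (v : unitary B) (hv : v * v = 1) :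
    Multiplicative (ZMod 2) →* unitary B where
  toFun g := if g = 1 then 1 else v
  map_one' := if_pos rfl
  map_mul' g k := by
    have h : ∀ g : Multiplicative (ZMod 2), g = 1 ∨ g = flipGen := by decide
    have h1 : flipGen ≠ 1 := by decide
    have h2 : flipGen * flipGen = 1 := by decide
    rcases h g with rfl | rfl <;> rcases h k with rfl | rfl <;> simp [h1, h2, hv]

/-- If the unitary `v` implements the flip in the representation `rep`, then so does `-v`. Every such
`v` of order two gives an extension of the vector state to the crossed product, with value
`⟪ξ, v ξ⟫` at the generator of `ℤ/2`. -/
theorem exists_extension (v : unitary (L2Interval →L[ℂ] L2Interval)) (hv : v * v = 1)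
    (hrep : ∀ a, (v : L2Interval →L[ℂ] L2Interval) * rep a = rep (CuntzAlgebra.flip a) * v) :
    ∃ ψ ∈ stateSpace (CrossedProduct flipAction),
      (∀ a, ψ (CrossedProduct.incl flipAction a) = rep.vectorFunctional unitVector a) ∧
      ψ (CrossedProduct.translation flipAction flipGen)
        = inner ℂ unitVector ((v : L2Interval →L[ℂ] L2Interval) unitVector) := by
  obtain ⟨Φ, ⟨hΦ, hΦ'⟩, -⟩ := CrossedProduct.existsUnique_lift flipAction rep (involutionRep v hv)
    fun g a => by
      have h : ∀ g : Multiplicative (ZMod 2), g = 1 ∨ g = flipGen := by decide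
      rcases h g with rfl | rfl
      · rw [map_one, map_one]
        exact (one_mul _).trans (mul_one _).symm
      · rw [flipAction_flipGen]
        exact hrep a
  refine ⟨Φ.vectorFunctional unitVector, Φ.vectorFunctional_mem_stateSpace norm_unitVector,
    fun a => ?_, ?_⟩
  · rw [StarAlgHom.vectorFunctional_apply, hΦ, StarAlgHom.vectorFunctional_apply]
  · rw [StarAlgHom.vectorFunctional_apply, hΦ']
    rfl

theorem not_hasPureExtensionProperty :
    ¬ HasPureExtensionProperty (CrossedProduct.incl flipAction) := by
  intro h
  have hU : reflUnitary * reflUnitary = 1 := Subtype.ext refl_mul_refl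
  have hrep : ∀ a, refl * rep a = rep (CuntzAlgebra.flip a) * refl := fun a => by
    rw [rep_flip, star_refl, mul_assoc, refl_mul_refl, mul_one]
  obtain ⟨ψ, hψ, hψφ, h1⟩ := exists_extension reflUnitary hU hrep
  obtain ⟨ψ', hψ', hψφ', h1'⟩ := exists_extension (-reflUnitary)
      (Subtype.ext ((neg_mul_neg refl refl).trans refl_mul_refl)) fun a => by
    rw [Unitary.coe_neg, neg_mul, mul_neg]
    exact congrArg _ (hrep a)
  have heq := (h _ vectorFunctional_mem_pureStates).unique ⟨hψ, hψφ⟩ ⟨hψ', hψφ'⟩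
  have hfix : refl unitVector = unitVector := by rw [unitVector, map_smul, refl_one]
  have hone : inner ℂ unitVector unitVector = (1 : ℂ) := by
    rw [inner_self_eq_norm_sq_to_K, norm_unitVector]
    simp
  have e1 : ψ (CrossedProduct.translation flipAction flipGen) = 1 := by
    rw [h1]
    change inner ℂ unitVector (refl unitVector) = _
    rw [hfix, hone]
  have e2 : ψ' (CrossedProduct.translation flipAction flipGen) = -1 := by
    rw [h1']
    change inner ℂ unitVector (-(refl unitVector)) = _
    rw [hfix, inner_neg_right, hone]
  rw [heq, e2] at e1
  norm_num at e1

end IntervalRep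

end

theorem mainTheorem2 :
    -- the explicit irreducible representation, unitarily equivalent to its twist by the flip
    (∃ (π : CuntzAlgebra →⋆ₐ[ℂ] (L2Interval →L[ℂ] L2Interval))
        (U : unitary (L2Interval →L[ℂ] L2Interval)),
      (∀ f : L2Interval, π (CuntzAlgebra.s 0) f =ᵐ[volume.restrict (Set.Icc (-1 : ℝ) 1)]
        fun t => (√2 : ℂ) * (Set.Icc (0 : ℝ) 1).indicator (fun t => f (2 * t - 1)) t) ∧
      (∀ f : L2Interval, π (CuntzAlgebra.s 1) f =ᵐ[volume.restrict (Set.Icc (-1 : ℝ) 1)]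
        fun t => (√2 : ℂ) * (Set.Icc (-1 : ℝ) 0).indicator (fun t => f (2 * t + 1)) t) ∧
      IsIrreducibleRepresentation π ∧
      (∀ f : L2Interval, (U : L2Interval →L[ℂ] L2Interval) f
        =ᵐ[volume.restrict (Set.Icc (-1 : ℝ) 1)] fun t => f (-t)) ∧
      ∀ x : CuntzAlgebra, π (CuntzAlgebra.flipAction (Multiplicative.ofAdd 1) x) =
        (U : L2Interval →L[ℂ] L2Interval) * π x * star (U : L2Interval →L[ℂ] L2Interval)) ∧
    -- failure of the pure extension property
    ¬ HasPureExtensionProperty (CrossedProduct.incl CuntzAlgebra.flipAction) ∧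
    -- unique conditional expectation
    (∃! E : CrossedProduct CuntzAlgebra.flipAction →CP CuntzAlgebra,
      IsConditionalExpectation (CrossedProduct.incl CuntzAlgebra.flipAction) E) ∧
    -- unique pseudo-expectation
    (∀ (I : Type) [CStarAlgebra I] [PartialOrder I] [StarOrderedRing I]
        (κ : CuntzAlgebra →⋆ₐ[ℂ] I), IsInjectiveEnvelope κ →
      ∃! Φ : CrossedProduct CuntzAlgebra.flipAction →CP I,
        IsPseudoExpectation (CrossedProduct.incl CuntzAlgebra.flipAction) κ Φ) := by
  refine ⟨⟨IntervalRep.rep, IntervalRep.reflUnitary, fun f => ?_, fun f => ?_,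
    IntervalRep.isIrreducibleRepresentation_rep, IntervalRep.coeFn_refl, fun x => ?_⟩,
    IntervalRep.not_hasPureExtensionProperty, CuntzAlgebra.existsUnique_isConditionalExpectation,
    fun I _ _ _ κ hκ => CuntzAlgebra.existsUnique_isPseudoExpectation hκ⟩
  · rw [IntervalRep.rep_s, ← IntervalRep.half_zero]
    exact IntervalRep.coeFn_S 0 f
  · rw [IntervalRep.rep_s, ← IntervalRep.half_one]
    simp_rw [← sub_neg_eq_add (2 * _ : ℝ) 1]
    exact IntervalRep.coeFn_S 1 f
  · rw [CuntzAlgebra.flipAction_flipGen]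
    exact IntervalRep.rep_flip x
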